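/- Let $d\ge 1$ and $S\in\{\tfrac12,1,\tfrac32,\dots\}$. Let $(S^{(1)},S^{(2)},S^{(3)})$ be the spin-$S$ matrices on $\mathbb{C}^{2S+1}$. For finite $\Gamma\subset\mathbb{Z}^d$ let $\mathfrak{A}_\Gamma=\bigotimes_{x\in\Gamma}M_{2S+1}(\mathbb{C})$, let $\mathfrak{A}_{\rm loc}=\bigcup_\Gamma\mathfrak{A}_\Gamma$ (with $\mathfrak{A}_{\Gamma_1}\subset\mathfrak{A}_{\Gamma_2}$ through $A\mapsto A\otimes I$ for $\Gamma_1\subset\Gamma_2$), and let $\mathfrak{A}$, the quasi-local algebra, be the operator-norm completion of $\mathfrak{A}_{\rm loc}$. A state is a normalized positive linear functional on $\mathfrak{A}$. For $L\ge 1$ let $\Lambda=\Lambda_L=\{-L+1,\dots,L\}^d$, and for $B\in\mathbb{R}$ let $$H^{(\Lambda)}_{\rm p}(B)=H^{(\Lambda)}_{0,{\rm p}}-B\,O^{(\Lambda)},\qquad H^{(\Lambda)}_{0,{\rm p}}=\sum_{\{x,y\}}\mathbf{S}_x\cdot\mathbf{S}_y,\qquad O^{(\Lambda)}=\sum_{x\in\Lambda}(-1)^{x^{(1)}+\cdots+x^{(d)}}S^{(3)}_x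 ,$$ where the sum in $H^{(\Lambda)}_{0,{\rm p}}$ runs over the unordered pairs of nearest neighbours in $\Lambda$ with the periodic boundary condition. "Translation invariant with period 2" means: invariant, as a state, under the translations by $2v$, $v\in\mathbb{Z}^d$ (on $\Lambda_L$, taken modulo the side $2L$). A state $\omega$ is an infinite-volume ground state (for $B=0$) if $\lim_{\Lambda\nearrow\mathbb{Z}^d}\omega(a^*[H^{(\Lambda)}_{0,{\rm p}},a])\ge 0$ for all $a\in\mathfrak{A}_{\rm loc}$; its maximum spontaneous magnetization is $M(\omega)=\lim_{N\to\infty}\sup_{|\Lambda|\ge N}\frac1{|\Lambda|}\omega(O^{(\Lambda)})$. For $B>0$ there are normalized ground-state vectors $\Phi^{(\Lambda)}_0(B)$ of $H^{(\Lambda)}_{\rm p}(B)$, for all $\Lambda=\Lambda_L$, that are translation invariant with period 2; and for every such choice every sequence of boxes $\Lambda\nearrow\mathbb{Z}^d$ has a subsequence along which $\langle\Phi^{(\Lambda)}_0(B),(\cdot)\Phi^{(\Lambda)}_0(B)\rangle$ converges weak-$*$ to a state of $\mathfrak{A}$. **Theorem.** There is a real number $m_{\rm s}$ with the following properties. 1.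 Choose, for every $B>0$, ground-state vectors $\Phi^{(\Lambda)}_0(B)$ as above and a sequence of boxes $\Lambda\nearrow\mathbb{Z}^d$ (which may depend on $B$) along which the weak-$*$ limit $\omega_{\Phi_0(B)}$ exists. Then $m[\Phi_0(B)]:=\frac1{|\Lambda|}\omega_{\Phi_0(B)}(O^{(\Lambda)})$ does not depend on the box $\Lambda$, it equals $\lim_{\Lambda\nearrow\mathbb{Z}^d}\frac1{|\Lambda|}\langle\Phi^{(\Lambda)}_0(B),O^{(\Lambda)}\Phi^{(\Lambda)}_0(B)\rangle$ along the chosen sequence, and the limit $\lim_{B\searrow0}m[\Phi_0(B)]$ exists and equals $m_{\rm s}$. The value $m_{\rm s}$ does not depend on the choices. 2. $m_{\rm s}=\max_\omega M(\omega)$, the maximum being over all infinite-volume ground states $\omega$, translation invariant or not, and it is attained. 3. $m_{\rm s}$ is also the maximum, again attained, of the spontaneous magnetization $\lim_{\Lambda\nearrow\mathbb{Z}^d}\frac1{|\Lambda|}\omega(O^{(\Lambda)})$ over the infinite-volume ground states $\omega$ that are translation invariant with period 2. -/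

import Mathlib

open Filter Topology

noncomputable section

namespace Heisenberg

/-! ### Configurations and the quasi-local algebra

The spin is `S = n / 2`, so that the one-site space is `ℂ^(2S+1) = ℂ^(n+1)`. -/

/-- The sites of the hypercubic lattice `ℤ^d`. -/
abbrev Site (d : ℕ) : Type := Fin d → ℤ

/-- Labels of the product basis of `⨂_{x ∈ Γ} ℂ^(n+1)`. -/
abbrev LocConf {d : ℕ} (n : ℕ) (Γ : Finset (Site d)) : Type := Γ → Fin (n + 1)

/-- The matrix algebra `𝔄_Γ = ⨂_{x ∈ Γ} M_(n+1)(ℂ)`, as matrices in the product basis. -/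
abbrev LocMat {d : ℕ} (n : ℕ) (Γ : Finset (Site d)) : Type :=
  Matrix (LocConf n Γ) (LocConf n Γ) ℂ

/-- Configurations on the whole lattice. -/
abbrev Conf (d n : ℕ) : Type := Site d → Fin (n + 1)

/-- The Hilbert space `ℓ²` over all configurations; it only serves to represent all the matrix
algebras `𝔄_Γ` faithfully, and compatibly with the inclusions `Γ₁ ⊆ Γ₂`. -/
abbrev Hil (d n : ℕ) : Type := lp (fun _ : Conf d n => ℂ) 2

section Rep

variable {d n : ℕ} (Γ : Finset (Site d))

/-- Restriction of a configuration to `Γ`. -/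
def res (σ : Conf d n) : LocConf n Γ := fun x => σ x

/-- Replace the values of `σ` inside `Γ` by `τ`. -/
def glue (σ : Conf d n) (τ : LocConf n Γ) : Conf d n :=
  fun x => if h : x ∈ Γ then τ ⟨x, h⟩ else σ x

@[simp] theorem res_glue (σ : Conf d n) (τ : LocConf n Γ) : res Γ (glue Γ σ τ) = τ := by
  funext x; simp [res, glue]

@[simp] theorem glue_glue (σ : Conf d n) (τ ρ : LocConf n Γ) :
    glue Γ (glue Γ σ τ) ρ = glue Γ σ ρ := by
  funext x; by_cases h : x ∈ Γ <;> simp [glue, h]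

@[simp] theorem glue_res (σ : Conf d n) : glue Γ σ (res Γ σ) = σ := by
  funext x; by_cases h : x ∈ Γ <;> simp [glue, res, h]

/-- The involution `(σ, τ) ↦ (σ with τ inside Γ, σ restricted to Γ)`. -/
def swapEquiv : Conf d n × LocConf n Γ ≃ Conf d n × LocConf n Γ where
  toFun p := (glue Γ p.1 p.2, res Γ p.1)
  invFun p := (glue Γ p.1 p.2, res Γ p.1)
  left_inv p := by simp
  right_inv p := by simp

theorem summable_sq (ψ : Hil d n) : Summable fun σ => ‖ψ σ‖ ^ 2 := by
  simpa using (lp.memℓp ψ).summable (by norm_num)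

theorem norm_sq_eq (ψ : Hil d n) : ‖ψ‖ ^ 2 = ∑' σ, ‖ψ σ‖ ^ 2 := by
  simpa using lp.norm_rpow_eq_tsum (p := 2) (by norm_num) ψ

theorem hasSum_fst (ψ : Hil d n) : HasSum (fun p : Conf d n × LocConf n Γ => ‖ψ p.1‖ ^ 2)
    (Fintype.card (LocConf n Γ) * ‖ψ‖ ^ 2) := by
  have h1 : Summable (fun p : Conf d n × LocConf n Γ => ‖ψ p.1‖ ^ 2) := by
    have := (summable_sq ψ).mul_of_nonneg
      (Summable.of_finite (f := fun _ : LocConf n Γ => (1 : ℝ)))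
      (fun _ => by positivity) (fun _ => by positivity)
    simpa using this
  have h2 := h1.hasSum
  rw [h1.tsum_prod' (fun b => Summable.of_finite)] at h2
  simpa [tsum_fintype, tsum_mul_left, norm_sq_eq] using h2

theorem hasSum_glue (ψ : Hil d n) :
    HasSum (fun p : Conf d n × LocConf n Γ => ‖ψ (glue Γ p.1 p.2)‖ ^ 2)
      (Fintype.card (LocConf n Γ) * ‖ψ‖ ^ 2) :=
  (swapEquiv Γ).hasSum_iff.2 (hasSum_fst Γ ψ)

theorem summable_glue (ψ : Hil d n) :
    Summable fun σ : Conf d n => ∑ τ, ‖ψ (glue Γ σ τ)‖ ^ 2 := by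
  simpa [tsum_fintype] using (hasSum_glue Γ ψ).summable.prod

theorem tsum_glue (ψ : Hil d n) :
    ∑' σ : Conf d n, ∑ τ, ‖ψ (glue Γ σ τ)‖ ^ 2 = Fintype.card (LocConf n Γ) * ‖ψ‖ ^ 2 := by
  rw [← (hasSum_glue Γ ψ).tsum_eq,
    (hasSum_glue Γ ψ).summable.tsum_prod' (fun b => Summable.of_finite)]
  simp [tsum_fintype]

/-- The square of the Hilbert–Schmidt norm. -/
def hsSq (A : LocMat n Γ) : ℝ := ∑ ρ, ∑ τ, ‖A ρ τ‖ ^ 2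

theorem hsSq_nonneg (A : LocMat n Γ) : 0 ≤ hsSq Γ A := by
  unfold hsSq; positivity

/-- `A ⊗ I` acting on a function of configurations. -/
def actFun (A : LocMat n Γ) (f : Conf d n → ℂ) (σ : Conf d n) : ℂ :=
  ∑ τ, A (res Γ σ) τ * f (glue Γ σ τ)

theorem actFun_bound (A : LocMat n Γ) (f : Conf d n → ℂ) (σ : Conf d n) :
    ‖actFun Γ A f σ‖ ^ 2 ≤ hsSq Γ A * ∑ τ, ‖f (glue Γ σ τ)‖ ^ 2 := by
  have h1 : ‖actFun Γ A f σ‖ ≤ ∑ τ, ‖A (res Γ σ) τ‖ * ‖f (glue Γ σ τ)‖ := by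
    refine (norm_sum_le _ _).trans (le_of_eq ?_)
    simp
  have h2 : (∑ τ, ‖A (res Γ σ) τ‖ * ‖f (glue Γ σ τ)‖) ^ 2
      ≤ (∑ τ, ‖A (res Γ σ) τ‖ ^ 2) * ∑ τ, ‖f (glue Γ σ τ)‖ ^ 2 :=
    Finset.sum_mul_sq_le_sq_mul_sq _ _ _
  have h3 : ∑ τ, ‖A (res Γ σ) τ‖ ^ 2 ≤ hsSq Γ A :=
    Finset.single_le_sum (f := fun ρ => ∑ τ, ‖A ρ τ‖ ^ 2)
      (fun _ _ => by positivity) (Finset.mem_univ _)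
  calc ‖actFun Γ A f σ‖ ^ 2 ≤ (∑ τ, ‖A (res Γ σ) τ‖ * ‖f (glue Γ σ τ)‖) ^ 2 := by gcongr
    _ ≤ _ := h2
    _ ≤ _ := by gcongr

theorem actFun_summable (A : LocMat n Γ) (ψ : Hil d n) :
    Summable fun σ => ‖actFun Γ A ψ σ‖ ^ 2 :=
  Summable.of_nonneg_of_le (fun _ => by positivity) (fun σ => actFun_bound Γ A ψ σ)
    ((summable_glue Γ ψ).mul_left _)

theorem actFun_memℓp (A : LocMat n Γ) (ψ : Hil d n) : Memℓp (actFun Γ A ψ) 2 := by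
  apply memℓp_gen
  simpa using actFun_summable Γ A ψ

/-- `A ⊗ I` as a linear map on `ℓ²`. -/
def actLin (A : LocMat n Γ) : Hil d n →ₗ[ℂ] Hil d n where
  toFun ψ := ⟨actFun Γ A ψ, actFun_memℓp Γ A ψ⟩
  map_add' ψ φ := by
    ext σ
    change actFun Γ A _ σ = actFun Γ A _ σ + actFun Γ A _ σ
    simp [actFun, mul_add, Finset.sum_add_distrib]
  map_smul' c ψ := by
    ext σ
    simp only [actFun, lp.coeFn_smul, Pi.smul_apply, smul_eq_mul, RingHom.id_apply,
      Finset.mul_sum]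
    exact Finset.sum_congr rfl fun τ _ => by ring

theorem actLin_bound (A : LocMat n Γ) (ψ : Hil d n) :
    ‖actLin Γ A ψ‖ ≤ Real.sqrt (hsSq Γ A * Fintype.card (LocConf n Γ)) * ‖ψ‖ := by
  have h0 := hsSq_nonneg Γ A
  refine le_of_sq_le_sq ?_ (by positivity)
  rw [mul_pow, Real.sq_sqrt (by positivity), norm_sq_eq, mul_assoc, ← tsum_glue, ← tsum_mul_left]
  exact (actFun_summable Γ A ψ).tsum_le_tsum (fun σ => actFun_bound Γ A ψ σ)
    ((summable_glue Γ ψ).mul_left _)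

/-- `A ⊗ I` as a bounded operator on `ℓ²`. -/
def act (A : LocMat n Γ) : Hil d n →L[ℂ] Hil d n :=
  (actLin Γ A).mkContinuous _ (actLin_bound Γ A)

theorem act_apply (A : LocMat n Γ) (ψ : Hil d n) (σ : Conf d n) :
    act Γ A ψ σ = ∑ τ, A (res Γ σ) τ * ψ (glue Γ σ τ) := rfl

theorem act_mul (A B : LocMat n Γ) : act Γ (A * B) = act Γ A * act Γ B := by
  ext ψ σ
  change act Γ (A * B) ψ σ = act Γ A (act Γ B ψ) σ
  simp only [act_apply, res_glue, glue_glue, Matrix.mul_apply, Finset.sum_mul, Finset.mul_sum]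
  rw [Finset.sum_comm]
  exact Finset.sum_congr rfl fun _ _ => Finset.sum_congr rfl fun _ _ => by ring

theorem act_one : act Γ (1 : LocMat n Γ) = 1 := by
  ext ψ σ
  change act Γ 1 ψ σ = ψ σ
  simp [act_apply, Matrix.one_apply]

theorem act_add (A B : LocMat n Γ) : act Γ (A + B) = act Γ A + act Γ B := by
  ext ψ σ
  change act Γ (A + B) ψ σ = act Γ A ψ σ + act Γ B ψ σ
  simp [act_apply, add_mul, Finset.sum_add_distrib]

theorem act_smul (c : ℂ) (A : LocMat n Γ) : act Γ (c • A) = c • act Γ A := by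
  ext ψ σ
  change act Γ (c • A) ψ σ = c * act Γ A ψ σ
  simp [act_apply, Finset.mul_sum, mul_assoc]

theorem summable_pair (A : LocMat n Γ) (ψ φ : Hil d n) :
    Summable fun p : Conf d n × LocConf n Γ =>
      A p.2 (res Γ p.1) * (ψ p.1 * star (φ (glue Γ p.1 p.2))) := by
  refine Summable.of_norm_bounded
    (g := fun p => (1 + hsSq Γ A) * (‖ψ p.1‖ ^ 2 + ‖φ (glue Γ p.1 p.2)‖ ^ 2))
    (((hasSum_fst Γ ψ).summable.add (hasSum_glue Γ φ).summable).mul_left _) fun p => ?_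
  have h3 : ‖A p.2 (res Γ p.1)‖ ^ 2 ≤ hsSq Γ A :=
    (Finset.single_le_sum (f := fun τ => ‖A p.2 τ‖ ^ 2)
      (fun _ _ => by positivity) (Finset.mem_univ _)).trans
      (Finset.single_le_sum (f := fun ρ => ∑ τ, ‖A ρ τ‖ ^ 2)
        (fun _ _ => by positivity) (Finset.mem_univ p.2))
  have h4 : ‖A p.2 (res Γ p.1)‖ ≤ 1 + hsSq Γ A := by
    nlinarith [sq_nonneg (‖A p.2 (res Γ p.1)‖ - 1)]
  have h0 := hsSq_nonneg Γ A
  have h5 : ‖ψ p.1‖ * ‖φ (glue Γ p.1 p.2)‖ ≤ ‖ψ p.1‖ ^ 2 + ‖φ (glue Γ p.1 p.2)‖ ^ 2 := by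
    nlinarith [sq_nonneg (‖ψ p.1‖ - ‖φ (glue Γ p.1 p.2)‖), sq_nonneg (‖ψ p.1‖),
      sq_nonneg (‖φ (glue Γ p.1 p.2)‖)]
  rw [norm_mul, norm_mul, norm_star]
  gcongr

theorem act_star (A : LocMat n Γ) : act Γ (star A) = star (act Γ A) := by
  rw [ContinuousLinearMap.star_eq_adjoint, ContinuousLinearMap.eq_adjoint_iff]
  intro φ ψ
  have hs := summable_pair Γ A ψ φ
  have hs' : Summable fun p : Conf d n × LocConf n Γ =>
      A (res Γ p.1) p.2 * (ψ (glue Γ p.1 p.2) * star (φ p.1)) := by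
    have := (swapEquiv Γ).summable_iff.2 hs
    refine this.congr fun p => ?_
    simp [swapEquiv]
  have hl : inner ℂ (act Γ (star A) φ) ψ
      = ∑' p : Conf d n × LocConf n Γ, A p.2 (res Γ p.1) * (ψ p.1 * star (φ (glue Γ p.1 p.2))) := by
    rw [lp.inner_eq_tsum, hs.tsum_prod' (fun b => Summable.of_finite)]
    refine tsum_congr fun σ => ?_
    rw [tsum_fintype, act_apply, RCLike.inner_apply, map_sum, Finset.mul_sum]
    refine Finset.sum_congr rfl fun τ _ => ?_
    simp [Matrix.star_apply]
    ring
  have hr : inner ℂ φ (act Γ A ψ)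
      = ∑' p : Conf d n × LocConf n Γ, A (res Γ p.1) p.2 * (ψ (glue Γ p.1 p.2) * star (φ p.1)) := by
    rw [lp.inner_eq_tsum, hs'.tsum_prod' (fun b => Summable.of_finite)]
    refine tsum_congr fun σ => ?_
    rw [tsum_fintype, act_apply, RCLike.inner_apply, Finset.sum_mul]
    refine Finset.sum_congr rfl fun τ _ => ?_
    simp
    ring
  rw [hl, hr, ← (swapEquiv Γ).tsum_eq]
  refine tsum_congr fun p => ?_
  simp [swapEquiv]

/-- The faithful representation `A ↦ A ⊗ I` of `𝔄_Γ` on `ℓ²`. -/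
def locRep : LocMat n Γ →⋆ₐ[ℂ] (Hil d n →L[ℂ] Hil d n) where
  toFun := act Γ
  map_one' := act_one Γ
  map_mul' := act_mul Γ
  map_zero' := by simpa using act_smul Γ 0 (0 : LocMat n Γ)
  map_add' := act_add Γ
  commutes' c := by
    rw [Algebra.algebraMap_eq_smul_one, act_smul, act_one, Algebra.algebraMap_eq_smul_one]
  map_star' := act_star Γ

end Rep

/-- The inclusion `𝔄_Γ₁ → 𝔄_Γ₂`, `A ↦ A ⊗ I`, for `Γ₁ ⊆ Γ₂`. -/
def emb {d n : ℕ} {Γ₁ Γ₂ : Finset (Site d)} (h : Γ₁ ⊆ Γ₂) (A : LocMat n Γ₁) : LocMat n Γ₂ :=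
  Matrix.of fun σ τ =>
    if ∀ y : Γ₂, (y : Site d) ∉ Γ₁ → σ y = τ y then
      A (fun x => σ ⟨x, h x.2⟩) (fun x => τ ⟨x, h x.2⟩)
    else 0

theorem locRep_emb {d n : ℕ} {Γ₁ Γ₂ : Finset (Site d)} (h : Γ₁ ⊆ Γ₂) (A : LocMat n Γ₁) :
    locRep Γ₂ (emb h A) = locRep Γ₁ A := by
  ext ψ σ
  change act Γ₂ (emb h A) ψ σ = act Γ₁ A ψ σ
  simp only [act_apply, emb, Matrix.of_apply, ite_mul, zero_mul]
  rw [← Finset.sum_filter]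
  refine Finset.sum_bij' (fun τ _ => fun x : Γ₁ => τ ⟨x, h x.2⟩)
    (fun τ _ => fun y : Γ₂ => glue Γ₁ σ τ y) ?_ ?_ ?_ ?_ ?_
  · intro τ _; simp
  · intro τ _
    simp only [Finset.mem_filter, Finset.mem_univ, true_and]
    intro y hy
    simp [res, glue, hy]
  · intro τ hτ
    simp only [Finset.mem_filter, Finset.mem_univ, true_and] at hτ
    funext y
    by_cases hy : (y : Site d) ∈ Γ₁
    · simp [glue, hy]
    · simpa [glue, hy, res] using hτ y hy
  · intro τ _
    funext x
    simp [glue]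
  · intro τ hτ
    simp only [Finset.mem_filter, Finset.mem_univ, true_and] at hτ
    congr 1
    refine congrArg (fun ξ : Conf d n => ψ ξ) ?_
    funext x
    by_cases h1 : x ∈ Γ₁
    · simp [glue, h1, h h1]
    · by_cases h2 : x ∈ Γ₂
      · simpa [glue, h1, h2, res] using (hτ ⟨x, h2⟩ h1).symm
      · simp [glue, h1, h2]

/-- The algebra `𝔄_loc = ⋃_Γ 𝔄_Γ` of local observables. -/
def locAlg (d n : ℕ) : StarSubalgebra ℂ (Hil d n →L[ℂ] Hil d n) where
  carrier := {a | ∃ (Γ : Finset (Site d)) (A : LocMat n Γ), locRep Γ A = a}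
  mul_mem' := by
    rintro _ _ ⟨Γ₁, A, rfl⟩ ⟨Γ₂, B, rfl⟩
    refine ⟨Γ₁ ∪ Γ₂, emb Finset.subset_union_left A * emb Finset.subset_union_right B, ?_⟩
    rw [map_mul, locRep_emb, locRep_emb]
  add_mem' := by
    rintro _ _ ⟨Γ₁, A, rfl⟩ ⟨Γ₂, B, rfl⟩
    refine ⟨Γ₁ ∪ Γ₂, emb Finset.subset_union_left A + emb Finset.subset_union_right B, ?_⟩
    rw [map_add, locRep_emb, locRep_emb]
  algebraMap_mem' c := ⟨∅, algebraMap ℂ _ c, AlgHomClass.commutes _ c⟩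
  star_mem' := by
    rintro _ ⟨Γ, A, rfl⟩
    exact ⟨Γ, star A, map_star _ A⟩

/-- The quasi-local algebra `𝔄`: the operator-norm closure of `𝔄_loc`. -/
abbrev QL (d n : ℕ) : StarSubalgebra ℂ (Hil d n →L[ℂ] Hil d n) :=
  (locAlg d n).topologicalClosure

/-- The inclusion `𝔄_Γ → 𝔄`. -/
def ql {d n : ℕ} (Γ : Finset (Site d)) (A : LocMat n Γ) : QL d n :=
  ⟨locRep Γ A, (locAlg d n).le_topologicalClosure ⟨Γ, A, rfl⟩⟩

/-- A state: a normalized positive linear functional on the quasi-local algebra. -/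
def IsState {d n : ℕ} (ω : QL d n →ₗ[ℂ] ℂ) : Prop :=
  ω 1 = 1 ∧ ∀ a : QL d n, ∃ r : ℝ, 0 ≤ r ∧ ω (star a * a) = (r : ℂ)

/-- The translate by `v` of an observable in `𝔄_Γ`, an observable in `𝔄_(Γ + v)`. -/
def shiftMat {d n : ℕ} (v : Site d) {Γ : Finset (Site d)} (A : LocMat n Γ) :
    LocMat n (Γ.map (addRightEmbedding v)) :=
  A.submatrix
    (fun σ (x : Γ) => σ ⟨x + v, Finset.mem_map_of_mem (addRightEmbedding v) x.2⟩)
    (fun σ (x : Γ) => σ ⟨x + v, Finset.mem_map_of_mem (addRightEmbedding v) x.2⟩)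

/-- Translation invariance with period 2, i.e. invariance of the expectations of local
observables (hence, for a state, of all observables) under the translations by `2v`,
`v ∈ ℤ^d`. -/
def IsPeriodTwo {d n : ℕ} (ω : QL d n →ₗ[ℂ] ℂ) : Prop :=
  ∀ (v : Site d) (Γ : Finset (Site d)) (A : LocMat n Γ),
    ω (ql _ (shiftMat (2 • v) A)) = ω (ql Γ A)

/-! ### The Hamiltonian -/

/-- The raising operator `S⁺` of spin `n / 2` in the basis of eigenvectors of `S⁽³⁾`, ordered by
decreasing eigenvalue. -/
def spinPlus (n : ℕ) : Matrix (Fin (n + 1)) (Fin (n + 1)) ℂ :=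
  Matrix.of fun i j =>
    if (i : ℕ) + 1 = j then ((Real.sqrt ((j : ℝ) * ((n : ℝ) + 1 - (j : ℝ))) : ℝ) : ℂ) else 0

/-- The spin matrices `S⁽¹⁾`, `S⁽²⁾`, `S⁽³⁾` (indices `0`, `1`, `2`) of magnitude `n / 2`. -/
def spin (n : ℕ) : Fin 3 → Matrix (Fin (n + 1)) (Fin (n + 1)) ℂ :=
  ![(1 / 2 : ℂ) • (spinPlus n + (spinPlus n).conjTranspose),
    (-Complex.I / 2) • (spinPlus n - (spinPlus n).conjTranspose),
    Matrix.diagonal fun j => (n : ℂ) / 2 - ((j : ℕ) : ℂ)]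

/-- The spin operator `S_x⁽ʲ⁾` at the site `x`, as an element of `𝔄_Γ`. -/
def spinAt {d n : ℕ} {Γ : Finset (Site d)} (j : Fin 3) (x : Γ) : LocMat n Γ :=
  Matrix.of fun σ τ => if ∀ y, y ≠ x → σ y = τ y then spin n j (σ x) (τ x) else 0

/-- The box `Λ = {-L + 1, …, L}^d`. -/
def box (d L : ℕ) : Finset (Site d) :=
  Fintype.piFinset fun _ => Finset.Icc (-(L : ℤ) + 1) (L : ℤ)

/-- Nearest neighbours for the periodic boundary condition on the box of side `2L`. -/
def PerAdj {d : ℕ} (L : ℕ) (x y : Site d) : Prop :=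
  ∃ i, (x i ≡ y i + 1 [ZMOD 2 * L] ∨ y i ≡ x i + 1 [ZMOD 2 * L]) ∧ ∀ j, j ≠ i → x j = y j

instance {d : ℕ} (L : ℕ) (x y : Site d) : Decidable (PerAdj L x y) := by
  unfold PerAdj; infer_instance

/-- The Heisenberg antiferromagnet on the box with the periodic boundary condition,
`∑ S_x · S_y` over the unordered nearest-neighbour pairs; every pair occurs twice in the sum over
ordered pairs, which is compensated by the factor `1 / 2`. -/
def hamZero (d n L : ℕ) : LocMat n (box d L) :=
  (1 / 2 : ℂ) • ∑ x : box d L, ∑ y : box d L,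
    if PerAdj L (x : Site d) y then ∑ j : Fin 3, spinAt j x * spinAt j y else 0

/-- The order parameter `O = ∑_x (-1)^(x_1 + ⋯ + x_d) S_x⁽³⁾` of the box. -/
def stag (d n L : ℕ) : LocMat n (box d L) :=
  ∑ x : box d L, ((-1 : ℂ) ^ (∑ i, (x : Site d) i)) • spinAt 2 x

/-- The Hamiltonian `H(B) = H_0 - B O` in the staggered magnetic field `B`. -/
def ham (d n L : ℕ) (B : ℝ) : LocMat n (box d L) :=
  hamZero d n L - (B : ℂ) • stag d n L

/-! ### Finite-volume ground states -/

/-- The expectation `⟨Φ, A Φ⟩`. -/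
def expect {ι : Type*} [Fintype ι] (Φ : ι → ℂ) (A : Matrix ι ι ℂ) : ℂ :=
  star Φ ⬝ᵥ A.mulVec Φ

/-- `Φ` is a normalized eigenvector of `H` for the lowest eigenvalue. -/
def IsGroundVector {ι : Type*} [Fintype ι] (H : Matrix ι ι ℂ) (Φ : ι → ℂ) : Prop :=
  star Φ ⬝ᵥ Φ = 1 ∧ ∃ E : ℝ, H.mulVec Φ = (E : ℂ) • Φ ∧
    ∀ (E' : ℝ) (Ψ : ι → ℂ), Ψ ≠ 0 → H.mulVec Ψ = (E' : ℂ) • Ψ → E ≤ E'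

/-- Translation invariance with period 2 of (the state given by) a vector on the periodic box:
translating the configurations by `2v` modulo the side `2L` changes the vector by a phase only. -/
def IsPeriodTwoVector {d n L : ℕ} (Φ : LocConf n (box d L) → ℂ) : Prop :=
  ∀ v : Site d, ∃ c : ℂ, ‖c‖ = 1 ∧ ∀ σ τ : LocConf n (box d L),
    (∀ x y : box d L, (∀ i, (x : Site d) i ≡ (y : Site d) i + 2 * v i [ZMOD 2 * L]) →
      τ x = σ y) → Φ τ = c * Φ σ

/-- A choice, for every `L ≥ 1`, of a ground-state vector of `H(B)` on the box of side `2L` that is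
translation invariant with period 2. -/
def IsGroundFamily {d n : ℕ} (B : ℝ) (Φ : ∀ L : ℕ, LocConf n (box d L) → ℂ) : Prop :=
  ∀ L, 1 ≤ L → IsGroundVector (ham d n L B) (Φ L) ∧ IsPeriodTwoVector (Φ L)

/-- The expectation of a local observable `A ∈ 𝔄_Γ` in the vector `Φ` of the box, for `Γ`
contained in the box (and `0` otherwise). -/
def finExpect {d n L : ℕ} (Φ : LocConf n (box d L) → ℂ) {Γ : Finset (Site d)}
    (A : LocMat n Γ) : ℂ :=
  if h : Γ ⊆ box d L then expect Φ (emb h A) else 0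

/-- `ω` is the weak-* limit, along the sequence of boxes given by `ℓ k → ∞`, of the states given by
the vectors `Φ (ℓ k)`. -/
def IsWeakStarLimit {d n : ℕ} (Φ : ∀ L : ℕ, LocConf n (box d L) → ℂ) (ℓ : ℕ → ℕ)
    (ω : QL d n →ₗ[ℂ] ℂ) : Prop :=
  IsState ω ∧ ∀ (Γ : Finset (Site d)) (A : LocMat n Γ),
    Tendsto (fun k => finExpect (Φ (ℓ k)) A) atTop (𝓝 (ω (ql Γ A)))

/-! ### Infinite-volume ground states and magnetization -/

/-- `ω` is an infinite-volume ground state in zero field: a state with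
`lim_Λ ω(a* [H_0^Λ, a]) ≥ 0` for all local `a`. -/
def IsGroundState {d n : ℕ} (ω : QL d n →ₗ[ℂ] ℂ) : Prop :=
  IsState ω ∧ ∀ a : QL d n, (a : Hil d n →L[ℂ] Hil d n) ∈ locAlg d n →
    ∃ r : ℝ, 0 ≤ r ∧
      Tendsto (fun L => ω (star a * (ql _ (hamZero d n L) * a - a * ql _ (hamZero d n L))))
        atTop (𝓝 (r : ℂ))

/-- The staggered magnetization per site `ω(O^Λ) / |Λ|` in the box of side `2L`. -/
def magIn {d n : ℕ} (ω : QL d n →ₗ[ℂ] ℂ) (L : ℕ) : ℝ :=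
  (ω (ql _ (stag d n L))).re / ((box d L).card : ℝ)

/-- The staggered magnetization per site `⟨Φ, O^Λ Φ⟩ / |Λ|` of a vector of the box. -/
def magVec {d n L : ℕ} (Φ : LocConf n (box d L) → ℂ) : ℝ :=
  (expect Φ (stag d n L)).re / ((box d L).card : ℝ)

/-- The maximum spontaneous magnetization of `ω`, `lim_N sup_{|Λ| ≥ N} ω(O^Λ) / |Λ|`. -/
def maxMag {d n : ℕ} (ω : QL d n →ₗ[ℂ] ℂ) : ℝ :=
  limsup (fun L => magIn ω L) atTop

end Heisenberg

end

noncomputable section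

namespace Heisenberg

/-! ### States on the quasi-local algebra -/

section State

variable {d n : ℕ}

/-! The part concerning period two is variational. For a state of period two the energy of the cell
`{0, 1}^d` in the field B is an exchange part minus B times 2^d times the magnetization per site
(`cell_re`). For a ground vector of period two on the torus the total energy is exactly L^d cell
energies; for an arbitrary state of period two on the infinite lattice this holds up to a boundary
term. Dividing by the number of cells shows that every limit of ground vectors minimizes the cell
energy among all states of period two (`LocTendsto.cell_le`). This energy is affine in B, so
comparing minimizers at two fields B < B' makes the magnetization monotone, whatever choices were
made at either field (`LocTendsto.magIn_le`). All choices are therefore sandwiched by one reference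
choice, and their common limit at zero field is its infimum m_s.

For attainment, take fields tending to zero, a large box for each, and a weak-* limit of the ground
vectors. By periodicity the magnetization per site is the expectation of a fixed local observable,
so it passes to the limit and equals m_s. In a*[H(B), a] the field contributes B times a fixed local
observable, so the limit is a ground state in zero field (`LocTendsto.isGroundState`).

The upper bound must cover ground states without any translation invariance. Inserting a_τ = |Φ⟩⟨τ|
for all basis labels τ of a box into the ground-state inequality and summing replaces the state
inside the box by Φ: the sum of a_τ*[H, a_τ] is ⟨Φ, HΦ⟩ - H plus bonds crossing the boundary. Hence
the energy of a ground state in a box exceeds that of any vector by at most a surface term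
(`IsGroundState.hamZero_le`). Combined with the minimality of the ground vector in the field B, its
magnetization is at most that of this vector plus a surface-to-volume error divided by B
(`IsGroundState.magIn_le`). Large boxes are taken first, then B tends to zero. -/

theorem ext_ql {a b : QL d n} (h : (a : Hil d n →L[ℂ] Hil d n) = b) : a = b := Subtype.ext h

/-- The inclusion `𝔄_Γ → 𝔄` as a homomorphism of star algebras. -/
def qlHom (Γ : Finset (Site d)) : LocMat n Γ →⋆ₐ[ℂ] QL d n :=
  (locRep Γ).codRestrict _ fun A => (locAlg d n).le_topologicalClosure ⟨Γ, A, rfl⟩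

theorem ql_eq (Γ : Finset (Site d)) (A : LocMat n Γ) : ql Γ A = qlHom Γ A := rfl

theorem ql_emb {Γ₁ Γ₂ : Finset (Site d)} (h : Γ₁ ⊆ Γ₂) (A : LocMat n Γ₁) :
    ql Γ₂ (emb h A) = ql Γ₁ A := ext_ql (locRep_emb h A)

theorem ql_mem_locAlg (Γ : Finset (Site d)) (A : LocMat n Γ) :
    (ql Γ A : Hil d n →L[ℂ] Hil d n) ∈ locAlg d n := ⟨Γ, A, rfl⟩

/-- In the spectral order a*a is at most ‖a‖² times the unit, and a nonnegative element has the form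
b*b. This lets positivity alone bound a functional by the norm. -/
theorem exists_norm_sq_sub_eq_star_mul_self {A : Type*} [CStarAlgebra A] (a : A) :
    ∃ b : A, ((‖a‖ ^ 2 : ℝ) : ℂ) • 1 - star a * a = star b * b := by
  let _ : PartialOrder A := CStarAlgebra.spectralOrder _
  have : StarOrderedRing A := CStarAlgebra.spectralOrderedRing _
  have h := CStarAlgebra.star_mul_le_algebraMap_norm_sq (a := a)
  rw [← sub_nonneg, CStarAlgebra.nonneg_iff_eq_star_mul_self] at h
  obtain ⟨b, hb⟩ := h
  refine ⟨b, ?_⟩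
  rw [← hb, Algebra.algebraMap_eq_smul_one, Complex.coe_smul]

/-- Closedness makes `QL d n` itself a C⋆-algebra, so that b can be found inside it, where states
are defined. -/
theorem exists_star_mul_self_of_norm_le (a : QL d n) :
    ∃ b : QL d n, ((‖a‖ ^ 2 : ℝ) : ℂ) • 1 - star a * a = star b * b := by
  have : IsClosed (QL d n : Set (Hil d n →L[ℂ] Hil d n)) :=
    (locAlg d n).isClosed_topologicalClosure
  exact exists_norm_sq_sub_eq_star_mul_self a

namespace IsState

variable {ω : QL d n →ₗ[ℂ] ℂ}

theorem re_nonneg (h : IsState ω) (a : QL d n) : 0 ≤ (ω (star a * a)).re := by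
  obtain ⟨r, hr, e⟩ := h.2 a
  simpa [e] using hr

theorem im_eq_zero (h : IsState ω) (a : QL d n) : (ω (star a * a)).im = 0 := by
  obtain ⟨r, hr, e⟩ := h.2 a
  simp [e]

/-- The imaginary part of ω((a + i)*(a + i)) is Re ω(a*) - Re ω(a), and it vanishes by positivity.
-/
theorem apply_star_re (h : IsState ω) (a : QL d n) : (ω (star a)).re = (ω a).re := by
  have h2 := h.im_eq_zero (a + Complex.I • 1)
  have h3 := h.im_eq_zero a
  simp only [star_add, star_smul, star_one, add_mul, mul_add, map_add, map_smul, smul_mul_assoc,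
    mul_smul_comm, one_mul, mul_one, h.1, smul_eq_mul, Complex.add_im, h3] at h2
  simp at h2
  linarith

theorem re_star_mul_self_le (h : IsState ω) (a : QL d n) : (ω (star a * a)).re ≤ ‖a‖ ^ 2 := by
  obtain ⟨b, hb⟩ := exists_star_mul_self_of_norm_le a
  have := h.re_nonneg b
  rw [← hb, map_sub, map_smul, h.1] at this
  simpa [← Complex.ofReal_pow] using this

/-- Expand ω((t - a)*(t - a)) ≥ 0 for real t and take t = ‖a‖; when the norm vanishes, t = Re ω(a)
does the work. -/
theorem re_le_norm (h : IsState ω) (a : QL d n) : (ω a).re ≤ ‖a‖ := by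
  have key : ∀ t : ℝ, 2 * t * (ω a).re ≤ t ^ 2 + ‖a‖ ^ 2 := by
    intro t
    have h1 := h.re_nonneg ((t : ℂ) • 1 - a)
    have h2 := h.re_star_mul_self_le a
    have h3 := h.apply_star_re a
    simp only [star_sub, star_smul, star_one, sub_mul, mul_sub, map_sub, map_smul, smul_mul_assoc,
      mul_smul_comm, one_mul, mul_one, h.1, smul_eq_mul] at h1
    simp [h3] at h1
    nlinarith
  rcases (norm_nonneg a).eq_or_lt with h0 | h0
  · have := key 1
    have := key (ω a).re
    rw [← h0] at this ⊢
    nlinarith [sq_nonneg (ω a).re]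
  · have := key ‖a‖
    nlinarith

theorem abs_re_le_norm (h : IsState ω) (a : QL d n) : |(ω a).re| ≤ ‖a‖ := by
  rw [abs_le]
  have := h.re_le_norm (-a)
  rw [map_neg, norm_neg, Complex.neg_re] at this
  exact ⟨by linarith, h.re_le_norm a⟩

end IsState

/-! ### Vector states of finite volume -/

open scoped Classical in
/-- A vector of `⨂_{x ∈ Γ} ℂ^(n+1)`, extended by the constant configuration outside `Γ`. -/
def extVec {Γ : Finset (Site d)} (Φ : LocConf n Γ → ℂ) : Hil d n :=
  ∑ τ, lp.single 2 (glue Γ (fun _ => 0) τ) (Φ τ)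

open scoped Classical in
theorem extVec_glue {Γ : Finset (Site d)} (Φ : LocConf n Γ → ℂ) (τ : LocConf n Γ) :
    extVec Φ (glue Γ (fun _ => 0) τ) = Φ τ := by
  have hinj : ∀ τ ρ : LocConf n Γ, glue Γ (fun _ => 0) τ = glue Γ (fun _ => 0) ρ → τ = ρ := by
    intro τ ρ h
    simpa using congrArg (res Γ) h
  simp only [extVec, lp.coeFn_sum, Finset.sum_apply]
  rw [Finset.sum_eq_single τ]
  · simp
  · intro ρ _ hρ
    exact lp.single_apply_ne _ _ _ fun e => hρ (hinj _ _ e).symm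
  · simp

open scoped Classical in
theorem inner_extVec {Γ : Finset (Site d)} (Φ : LocConf n Γ → ℂ) (A : LocMat n Γ) :
    inner ℂ (extVec Φ) (locRep Γ A (extVec Φ)) = expect Φ A := by
  conv_lhs => rw [extVec, sum_inner]
  simp only [lp.inner_single_left, expect, dotProduct, Matrix.mulVec]
  refine Finset.sum_congr rfl fun τ _ => ?_
  change inner ℂ (Φ τ) (act Γ A (extVec Φ) _) = _
  simp only [act_apply, res_glue, glue_glue, extVec_glue, RCLike.inner_apply, Pi.star_apply,
    mul_comm, RCLike.star_def]

/-- The functional `a ↦ ⟨Φ, a Φ⟩` on the quasi-local algebra. -/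
def vecState {Γ : Finset (Site d)} (Φ : LocConf n Γ → ℂ) : QL d n →ₗ[ℂ] ℂ where
  toFun a := inner ℂ (extVec Φ) ((a : Hil d n →L[ℂ] Hil d n) (extVec Φ))
  map_add' a b := by simp
  map_smul' c a := by simp

theorem vecState_ql {Γ : Finset (Site d)} (Φ : LocConf n Γ → ℂ) (A : LocMat n Γ) :
    vecState Φ (ql Γ A) = expect Φ A := inner_extVec Φ A

/-- The states of different boxes thereby become functionals on one fixed algebra, where limits can
be taken. -/
theorem finExpect_eq {L : ℕ} (Φ : LocConf n (box d L) → ℂ) {Γ : Finset (Site d)}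
    (h : Γ ⊆ box d L) (A : LocMat n Γ) : finExpect Φ A = vecState Φ (ql Γ A) := by
  rw [finExpect, dif_pos h, ← vecState_ql, ql_emb]

theorem expect_one {Γ : Finset (Site d)} (Φ : LocConf n Γ → ℂ) :
    expect Φ 1 = star Φ ⬝ᵥ Φ := by simp [expect]

theorem norm_extVec {Γ : Finset (Site d)} {Φ : LocConf n Γ → ℂ} (h : star Φ ⬝ᵥ Φ = 1) :
    ‖extVec Φ‖ = 1 := by
  have h1 := inner_extVec Φ 1
  rw [map_one, one_apply_eq_self, inner_self_eq_norm_sq_to_K, expect_one, h] at h1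
  have h2 : ‖extVec Φ‖ ^ 2 = 1 := Complex.ofReal_injective (by simpa using h1)
  nlinarith [norm_nonneg (extVec Φ)]

theorem isState_vecState {Γ : Finset (Site d)} {Φ : LocConf n Γ → ℂ} (h : star Φ ⬝ᵥ Φ = 1) :
    IsState (vecState Φ) := by
  refine ⟨?_, fun a => ⟨‖(a : Hil d n →L[ℂ] Hil d n) (extVec Φ)‖ ^ 2, by positivity, ?_⟩⟩
  · have := vecState_ql Φ 1
    rwa [ql_eq, map_one, expect_one, h] at this
  · change inner ℂ (extVec Φ) ((star (a : Hil d n →L[ℂ] Hil d n)) ((a : Hil d n →L[ℂ] Hil d n)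
      (extVec Φ))) = _
    rw [ContinuousLinearMap.star_eq_adjoint, ContinuousLinearMap.adjoint_inner_right,
      inner_self_eq_norm_sq_to_K]
    push_cast; rfl

theorem norm_vecState_le {Γ : Finset (Site d)} {Φ : LocConf n Γ → ℂ} (h : star Φ ⬝ᵥ Φ = 1)
    (a : QL d n) : ‖vecState Φ a‖ ≤ ‖a‖ := by
  change ‖inner ℂ (extVec Φ) ((a : Hil d n →L[ℂ] Hil d n) (extVec Φ))‖ ≤ _
  refine (norm_inner_le_norm _ _).trans ?_
  rw [norm_extVec h, one_mul]
  simpa [norm_extVec h] using (a : Hil d n →L[ℂ] Hil d n).le_opNorm (extVec Φ)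

/-! ### Commutation of observables with disjoint supports -/

theorem ql_commute {Γ₁ Γ₂ : Finset (Site d)} (h : Disjoint Γ₁ Γ₂) (A : LocMat n Γ₁)
    (B : LocMat n Γ₂) : Commute (ql Γ₁ A) (ql Γ₂ B) := by
  refine ext_ql ?_
  change act Γ₁ A * act Γ₂ B = act Γ₂ B * act Γ₁ A
  ext ψ σ
  change act Γ₁ A (act Γ₂ B ψ) σ = act Γ₂ B (act Γ₁ A ψ) σ
  simp only [act_apply, Finset.mul_sum]
  rw [Finset.sum_comm]
  refine Finset.sum_congr rfl fun ρ _ => Finset.sum_congr rfl fun τ _ => ?_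
  have h1 : res Γ₂ (glue Γ₁ σ τ) = res Γ₂ σ := by
    funext x
    simp [res, glue, Finset.disjoint_right.1 h x.2]
  have h2 : res Γ₁ (glue Γ₂ σ ρ) = res Γ₁ σ := by
    funext x
    simp [res, glue, Finset.disjoint_left.1 h x.2]
  have h3 : glue Γ₂ (glue Γ₁ σ τ) ρ = glue Γ₁ (glue Γ₂ σ ρ) τ := by
    funext x
    by_cases hx : x ∈ Γ₁
    · simp [glue, hx, Finset.disjoint_left.1 h hx]
    · simp [glue, hx]
  rw [h1, h2, h3]
  ring

end State

/-! ### Spin operators and bonds in the quasi-local algebra -/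

section Spin

variable {d n : ℕ}

/-- The spin operator at the site `x` as an element of the quasi-local algebra. -/
def spinQ (n : ℕ) {d : ℕ} (j : Fin 3) (x : Site d) : QL d n :=
  ql {x} (spinAt j ⟨x, Finset.mem_singleton_self x⟩)

theorem emb_spinAt {Γ₁ Γ₂ : Finset (Site d)} (h : Γ₁ ⊆ Γ₂) (j : Fin 3) (x : Γ₁) :
    emb h (spinAt (n := n) j x) = spinAt j ⟨x, h x.2⟩ := by
  ext σ τ
  simp only [emb, spinAt, Matrix.of_apply]
  by_cases h1 : ∀ y : Γ₂, y ≠ ⟨x, h x.2⟩ → σ y = τ y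
  · rw [if_pos h1, if_pos, if_pos]
    · intro y hy
      exact h1 _ fun e => hy (Subtype.ext (by simpa using congrArg Subtype.val e))
    · intro y hy
      refine h1 y fun e => hy ?_
      rw [e]; exact x.2
  · rw [if_neg h1]
    split_ifs with h2 h3
    · refine absurd (fun y hy => ?_) h1
      by_cases hy1 : (y : Site d) ∈ Γ₁
      · exact h3 ⟨y, hy1⟩ fun e => hy (Subtype.ext (by simpa using congrArg Subtype.val e))
      · exact h2 y hy1
    · rfl
    · rfl

theorem ql_spinAt {Γ : Finset (Site d)} (j : Fin 3) (x : Γ) :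
    ql Γ (spinAt (n := n) j x) = spinQ n j (x : Site d) := by
  rw [spinQ, ← ql_emb (Finset.singleton_subset_iff.2 x.2), emb_spinAt]

theorem spinQ_commute {j : Fin 3} {x : Site d} {Γ : Finset (Site d)} (h : x ∉ Γ)
    (A : LocMat n Γ) : Commute (spinQ n j x) (ql Γ A) :=
  ql_commute (by simpa using h) _ _

/-- `S_x · S_y` in the quasi-local algebra. -/
def bond (n : ℕ) {d : ℕ} (x y : Site d) : QL d n := ∑ j : Fin 3, spinQ n j x * spinQ n j y

theorem ql_bond {Γ : Finset (Site d)} (x y : Γ) :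
    ql Γ (∑ j : Fin 3, spinAt (n := n) j x * spinAt j y) = bond n (x : Site d) y := by
  simp only [ql_eq, map_sum, map_mul, bond]
  simp only [← ql_eq, ql_spinAt]

theorem spinQ_mem_locAlg (j : Fin 3) (x : Site d) :
    (spinQ n j x : Hil d n →L[ℂ] Hil d n) ∈ locAlg d n := ql_mem_locAlg _ _

theorem bond_mem_locAlg (x y : Site d) :
    (bond n x y : Hil d n →L[ℂ] Hil d n) ∈ locAlg d n := by
  rw [← ql_bond (Γ := {x, y}) ⟨x, by simp⟩ ⟨y, by simp⟩]
  exact ql_mem_locAlg _ _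

theorem spin_conjTranspose (n : ℕ) (j : Fin 3) : (spin n j).conjTranspose = spin n j := by
  fin_cases j
  · simp [spin, Matrix.conjTranspose_smul, add_comm]
  · simp only [spin, Fin.mk_one, Matrix.cons_val_one, Matrix.cons_val_zero,
      Matrix.conjTranspose_smul, Matrix.conjTranspose_sub, Matrix.conjTranspose_conjTranspose]
    rw [← neg_sub (spinPlus n), smul_neg, ← neg_smul]
    congr 1
    simp [neg_div]
  · simp only [spin, Fin.reduceFinMk, Matrix.cons_val, Matrix.diagonal_conjTranspose]
    congr 1
    funext i
    simp

theorem star_spinAt {Γ : Finset (Site d)} (j : Fin 3) (x : Γ) :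
    star (spinAt (n := n) j x) = spinAt j x := by
  ext σ τ
  have h := congrFun (congrFun (spin_conjTranspose n j) (σ x)) (τ x)
  simp only [Matrix.conjTranspose_apply] at h
  simp only [Matrix.star_apply, spinAt, Matrix.of_apply, eq_comm (a := τ _)]
  split_ifs
  · exact h
  · simp

/-- A bound on the norm of the spin operators. -/
def spinBound (n : ℕ) : ℝ :=
  Real.sqrt (((n + 1) * ((n + 1) * (∑ j, ∑ a, ∑ b, ‖spin n j a b‖) ^ 2)) * (n + 1))

theorem spinBound_nonneg (n : ℕ) : 0 ≤ spinBound n := Real.sqrt_nonneg _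

/-- A crude Hilbert–Schmidt bound; only its independence of the site matters. -/
theorem norm_spinQ_le (j : Fin 3) (x : Site d) : ‖spinQ n j x‖ ≤ spinBound n := by
  have hc : (Fintype.card (LocConf n ({x} : Finset (Site d))) : ℝ) = n + 1 := by simp
  have h1 : ‖act {x} (spinAt (n := n) j ⟨x, Finset.mem_singleton_self x⟩)‖ ≤ _ :=
    LinearMap.mkContinuous_norm_le _ (Real.sqrt_nonneg _) _
  refine h1.trans (Real.sqrt_le_sqrt ?_)
  rw [hc]
  refine mul_le_mul_of_nonneg_right ?_ (by positivity)
  have h2 : ∀ ρ τ, ‖spinAt (n := n) j (⟨x, Finset.mem_singleton_self x⟩ : ({x} : Finset (Site d)))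
      ρ τ‖ ^ 2 ≤ (∑ j, ∑ a, ∑ b, ‖spin n j a b‖) ^ 2 := by
    intro ρ τ
    have h3 : ∀ a b, ‖spin n j a b‖ ≤ ∑ j, ∑ a, ∑ b, ‖spin n j a b‖ := fun a b =>
      ((Finset.single_le_sum (f := fun b => ‖spin n j a b‖) (fun _ _ => by positivity)
        (Finset.mem_univ b)).trans
      (Finset.single_le_sum (f := fun a => ∑ b, ‖spin n j a b‖) (fun _ _ => by positivity)
        (Finset.mem_univ a))).trans
      (Finset.single_le_sum (f := fun j => ∑ a, ∑ b, ‖spin n j a b‖) (fun _ _ => by positivity)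
        (Finset.mem_univ j))
    simp only [spinAt, Matrix.of_apply]
    split_ifs
    · gcongr; exact h3 _ _
    · simp; positivity
  calc hsSq _ _ ≤ ∑ ρ : LocConf n ({x} : Finset (Site d)), ∑ τ : LocConf n ({x} : Finset (Site d)),
        (∑ j, ∑ a, ∑ b, ‖spin n j a b‖) ^ 2 :=
        Finset.sum_le_sum fun ρ _ => Finset.sum_le_sum fun τ _ => h2 ρ τ
    _ = _ := by
        simp only [Finset.sum_const, Finset.card_univ, nsmul_eq_mul, hc]

theorem norm_bond_le (x y : Site d) : ‖bond n x y‖ ≤ 3 * spinBound n ^ 2 := by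
  have h : ∀ j ∈ (Finset.univ : Finset (Fin 3)),
      ‖spinQ n j x * spinQ n j y‖ ≤ spinBound n ^ 2 := fun j _ => by
    rw [sq]
    exact (norm_mul_le _ _).trans (mul_le_mul (norm_spinQ_le _ _) (norm_spinQ_le _ _)
      (norm_nonneg _) (spinBound_nonneg n))
  refine (norm_sum_le_of_le _ h).trans (le_of_eq ?_)
  simp

/-- The sign `(-1)^(x_1 + ⋯ + x_d)`. -/
def sgn (x : Site d) : ℂ := (-1 : ℂ) ^ (∑ i, x i)

theorem norm_sgn (x : Site d) : ‖sgn x‖ = 1 := by simp [sgn]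

theorem ql_stag (L : ℕ) : ql _ (stag d n L) = ∑ x ∈ box d L, sgn x • spinQ n 2 x := by
  simp only [stag, ql_eq, map_sum, map_smul]
  simp only [← ql_eq, ql_spinAt]
  exact Finset.sum_coe_sort (box d L) (fun x => sgn x • spinQ n 2 x)

theorem ql_hamZero (L : ℕ) : ql _ (hamZero d n L) =
    (1 / 2 : ℂ) • ∑ x ∈ box d L, ∑ y ∈ (box d L).filter (PerAdj L x), bond n x y := by
  simp only [hamZero, ql_eq, map_sum, map_smul]
  congr 1
  rw [← Finset.sum_coe_sort (box d L)]
  refine Finset.sum_congr rfl fun x _ => ?_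
  rw [Finset.sum_filter, ← Finset.sum_coe_sort (box d L)]
  refine Finset.sum_congr rfl fun y _ => ?_
  split_ifs
  · exact ql_bond x y
  · exact map_zero _

theorem ql_ham (L : ℕ) (B : ℝ) :
    ql _ (ham d n L B) = ql _ (hamZero d n L) - (B : ℂ) • ql _ (stag d n L) := by
  simp only [ham, ql_eq, map_sub, map_smul]

end Spin

/-! ### Combinatorics of boxes -/

section Lattice

variable {d : ℕ}

theorem mem_box {L : ℕ} {x : Site d} : x ∈ box d L ↔ ∀ i, -(L : ℤ) + 1 ≤ x i ∧ x i ≤ L := by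
  simp [box]

theorem card_box (d L : ℕ) : (box d L).card = (2 * L) ^ d := by
  rw [box, Fintype.card_piFinset]
  simp only [Int.card_Icc, Finset.prod_const, Finset.card_univ, Fintype.card_fin]
  congr 1
  omega

theorem box_mono {L L' : ℕ} (h : L ≤ L') : box d L ⊆ box d L' := by
  intro x hx
  rw [mem_box] at hx ⊢
  intro i
  have := hx i
  omega

theorem exists_subset_box (Γ : Finset (Site d)) : ∃ L : ℕ, Γ ⊆ box d L := by
  induction Γ using Finset.induction_on with
  | empty => exact ⟨0, by simp⟩
  | insert x Γ _ ih =>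
    obtain ⟨L, hL⟩ := ih
    refine ⟨L + ∑ i, (x i).natAbs + 1, Finset.insert_subset ?_ (hL.trans (box_mono (by omega)))⟩
    rw [mem_box]
    intro i
    have : (x i).natAbs ≤ ∑ i, (x i).natAbs :=
      Finset.single_le_sum (f := fun i => (x i).natAbs) (fun _ _ => Nat.zero_le _)
        (Finset.mem_univ i)
    omega

/-! ### Residues modulo the side and translations of the periodic box -/

theorem modEq_of_eq {a b m : ℤ} (h : a = b) : a ≡ b [ZMOD m] := h ▸ Int.ModEq.refl a

/-- Residues modulo `2L` are represented uniquely in `{-L + 1, …, L}`. -/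
theorem eq_of_modEq {L : ℕ} {a b : ℤ} (ha : -(L : ℤ) + 1 ≤ a ∧ a ≤ L)
    (hb : -(L : ℤ) + 1 ≤ b ∧ b ≤ L) (h : a ≡ b [ZMOD 2 * L]) : a = b := by
  obtain ⟨k, hk⟩ := h.dvd
  have h1 : k < 1 := by
    by_contra! h
    nlinarith
  have h2 : -1 < k := by
    by_contra! h
    nlinarith
  have : k = 0 := by omega
  subst this
  omega

/-- The representative of `z` modulo `2L` in `{-L + 1, …, L}`. -/
def wrap (L : ℕ) (z : ℤ) : ℤ := (z + L - 1) % (2 * L) - L + 1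

theorem wrap_mem {L : ℕ} (hL : 1 ≤ L) (z : ℤ) : -(L : ℤ) + 1 ≤ wrap L z ∧ wrap L z ≤ L := by
  have h1 := Int.emod_nonneg (z + L - 1) (b := 2 * L) (by omega)
  have h2 := Int.emod_lt_of_pos (z + L - 1) (b := 2 * L) (by omega)
  unfold wrap
  omega

theorem wrap_modEq (L : ℕ) (z : ℤ) : wrap L z ≡ z [ZMOD 2 * L] := by
  have h := (Int.mod_modEq (z + L - 1) (2 * L)).add_right (-L + 1)
  have e : z + L - 1 + (-L + 1) = z := by ring
  rw [e] at h
  unfold wrap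
  convert h using 1
  ring

/-- Translation by `2v` on the periodic box of side `2L`. -/
def boxShift (L : ℕ) (v x : Site d) : Site d := fun i => wrap L (x i + 2 * v i)

theorem boxShift_mem {L : ℕ} (hL : 1 ≤ L) (v x : Site d) : boxShift L v x ∈ box d L :=
  mem_box.2 fun _ => wrap_mem hL _

theorem boxShift_modEq (L : ℕ) (v x : Site d) (i : Fin d) :
    boxShift L v x i ≡ x i + 2 * v i [ZMOD 2 * L] := wrap_modEq _ _

theorem eq_boxShift {L : ℕ} (hL : 1 ≤ L) {v x y : Site d} (hx : x ∈ box d L)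
    (h : ∀ i, x i ≡ y i + 2 * v i [ZMOD 2 * L]) : x = boxShift L v y :=
  funext fun i => eq_of_modEq (mem_box.1 hx i) (wrap_mem hL _) ((h i).trans (wrap_modEq _ _).symm)

theorem boxShift_boxShift {L : ℕ} (hL : 1 ≤ L) (u v x : Site d) :
    boxShift L u (boxShift L v x) = boxShift L (u + v) x := by
  refine eq_boxShift hL (boxShift_mem hL _ _) fun i => ?_
  refine (boxShift_modEq _ _ _ i).trans (((boxShift_modEq L v x i).add_right _).trans ?_)
  rw [Pi.add_apply]
  exact modEq_of_eq (by ring)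

theorem boxShift_zero {L : ℕ} (hL : 1 ≤ L) {x : Site d} (hx : x ∈ box d L) :
    boxShift L 0 x = x :=
  (eq_boxShift hL hx fun i => by simp).symm

/-- Translation by `2v` on the periodic box as a permutation. -/
def boxPerm {L : ℕ} (hL : 1 ≤ L) (v : Site d) : Equiv.Perm (box d L) where
  toFun x := ⟨boxShift L v x, boxShift_mem hL _ _⟩
  invFun x := ⟨boxShift L (-v) x, boxShift_mem hL _ _⟩
  left_inv x := Subtype.ext <| by
    simp only [boxShift_boxShift hL, neg_add_cancel, boxShift_zero hL x.2]
  right_inv x := Subtype.ext <| by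
    simp only [boxShift_boxShift hL, add_neg_cancel, boxShift_zero hL x.2]

theorem perAdj_symm {L : ℕ} {x y : Site d} (h : PerAdj L x y) : PerAdj L y x := by
  obtain ⟨i, h1, h2⟩ := h
  exact ⟨i, h1.symm, fun j hj => (h2 j hj).symm⟩

theorem perAdj_boxShift_aux {L : ℕ} (v : Site d) {x y : Site d} (h : PerAdj L x y) :
    PerAdj L (boxShift L v x) (boxShift L v y) := by
  obtain ⟨i, h1, h2⟩ := h
  have key : ∀ {x y : Site d}, x i ≡ y i + 1 [ZMOD 2 * L] →
      boxShift L v x i ≡ boxShift L v y i + 1 [ZMOD 2 * L] := fun {x y} h =>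
    ((boxShift_modEq L v x i).trans (h.add_right _)).trans
      ((modEq_of_eq (by ring)).trans ((boxShift_modEq L v y i).add_right 1).symm)
  refine ⟨i, h1.imp key key, fun j hj => ?_⟩
  simp only [boxShift, h2 j hj]

theorem perAdj_boxShift {L : ℕ} (hL : 1 ≤ L) (v : Site d) {x y : Site d} (hx : x ∈ box d L)
    (hy : y ∈ box d L) : PerAdj L (boxShift L v x) (boxShift L v y) ↔ PerAdj L x y := by
  refine ⟨fun h => ?_, perAdj_boxShift_aux v⟩
  have := perAdj_boxShift_aux (-v) h
  rwa [boxShift_boxShift hL, boxShift_boxShift hL, neg_add_cancel, boxShift_zero hL hx,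
    boxShift_zero hL hy] at this

/-! ### Nearest neighbours and the boundary of a box -/

/-- The nearest neighbours of a site of `ℤ^d`. -/
def nbrs (x : Site d) : Finset (Site d) :=
  (Fintype.piFinset fun i => Finset.Icc (x i - 1) (x i + 1)).filter fun y =>
    ∃ i, (x i = y i + 1 ∨ y i = x i + 1) ∧ ∀ j, j ≠ i → x j = y j

theorem mem_nbrs {x y : Site d} :
    y ∈ nbrs x ↔ ∃ i, (x i = y i + 1 ∨ y i = x i + 1) ∧ ∀ j, j ≠ i → x j = y j := by
  simp only [nbrs, Finset.mem_filter, Fintype.mem_piFinset, Finset.mem_Icc, and_iff_right_iff_imp]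
  rintro ⟨i, h1, h2⟩ j
  by_cases hj : j = i
  · subst hj; omega
  · have := h2 j hj; omega

theorem add_mem_nbrs {x y v : Site d} : y + v ∈ nbrs (x + v) ↔ y ∈ nbrs x := by
  simp only [mem_nbrs, Pi.add_apply, add_left_inj, add_right_comm _ _ (1 : ℤ)]

theorem card_nbrs_le (x : Site d) : (nbrs x).card ≤ 3 ^ d := by
  refine (Finset.card_filter_le _ _).trans ?_
  rw [Fintype.card_piFinset]
  refine (Finset.prod_le_prod' (g := fun _ => 3) fun i _ => ?_).trans (by simp)
  rw [Int.card_Icc]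
  omega

/-- Each coordinate of a periodic neighbour of x has at most three possible values. This crude count
also covers the small boxes, in which neighbours may coincide. -/
theorem card_filter_perAdj_le (L : ℕ) (x : Site d) :
    ((box d L).filter (PerAdj L x)).card ≤ 3 ^ d := by
  have hsub : (box d L).filter (PerAdj L x) ⊆
      Fintype.piFinset fun i => {wrap L (x i - 1), x i, wrap L (x i + 1)} := by
    intro y hy
    obtain ⟨hy, i, h1, h2⟩ := Finset.mem_filter.1 hy
    rw [mem_box] at hy
    rw [Fintype.mem_piFinset]
    intro j
    simp only [Finset.mem_insert, Finset.mem_singleton]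
    by_cases hj : j = i
    · subst hj
      have hL : 1 ≤ L := by have := hy j; omega
      rcases h1 with h1 | h1
      · left
        refine eq_of_modEq (hy j) (wrap_mem hL _) (Int.ModEq.trans ?_ (wrap_modEq _ _).symm)
        simpa using (h1.sub_right 1).symm
      · right; right
        exact eq_of_modEq (hy j) (wrap_mem hL _) (h1.trans (wrap_modEq _ _).symm)
    · exact Or.inr (Or.inl (h2 j hj).symm)
  refine (Finset.card_le_card hsub).trans ?_
  rw [Fintype.card_piFinset]
  exact (Finset.prod_le_prod' (g := fun _ => 3) fun i _ => Finset.card_le_three).trans (by simp)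

/-- Sites of the box away from its boundary. -/
def Interior (L : ℕ) (x : Site d) : Prop := ∀ i, -(L : ℤ) + 1 < x i ∧ x i < L

instance (L : ℕ) (x : Site d) : Decidable (Interior L x) := by
  unfold Interior; infer_instance

theorem interior_of_mem_box {L L' : ℕ} (h : L < L') {x : Site d} (hx : x ∈ box d L) :
    Interior L' x := fun i => by have := mem_box.1 hx i; omega

theorem mem_box_of_mem_nbrs {L : ℕ} {x y : Site d} (hx : Interior L x) (hy : y ∈ nbrs x) :
    y ∈ box d L := by
  obtain ⟨i, h1, h2⟩ := mem_nbrs.1 hy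
  rw [mem_box]
  intro j
  have := hx j
  by_cases hj : j = i
  · subst hj; omega
  · have := h2 j hj; omega

/-- At an interior site neither step leaves the box, so the congruences modulo the side are
equalities. -/
theorem filter_perAdj_of_interior {L : ℕ} {x : Site d} (hx : Interior L x) :
    (box d L).filter (PerAdj L x) = nbrs x := by
  ext y
  simp only [Finset.mem_filter]
  constructor
  · rintro ⟨hy, i, h1, h2⟩
    refine mem_nbrs.2 ⟨i, ?_, h2⟩
    have hi := hx i
    have hy := mem_box.1 hy i
    rcases h1 with h1 | h1
    · left
      have := eq_of_modEq hy (b := x i - 1) ⟨by omega, by omega⟩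
        (by simpa using (h1.sub_right 1).symm)
      omega
    · right
      exact eq_of_modEq hy ⟨by omega, by omega⟩ h1
  · intro hy
    refine ⟨mem_box_of_mem_nbrs hx hy, ?_⟩
    obtain ⟨i, h1, h2⟩ := mem_nbrs.1 hy
    exact ⟨i, h1.imp modEq_of_eq modEq_of_eq, h2⟩

/-- The boundary sites of the box. -/
def bdry (d L : ℕ) : Finset (Site d) := (box d L).filter fun x => ¬ Interior L x

theorem card_bdry_le (d : ℕ) {L : ℕ} (hL : 1 ≤ L) :
    ((bdry d L).card : ℝ) ≤ (2 * L : ℝ) ^ d - (2 * L - 2 : ℝ) ^ d := by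
  have h1 : (box d L).filter (Interior L) =
      Fintype.piFinset fun _ => Finset.Icc (-(L : ℤ) + 2) (L - 1) := by
    ext x
    simp only [Finset.mem_filter, mem_box, Interior, Fintype.mem_piFinset, Finset.mem_Icc]
    constructor
    · rintro ⟨_, h⟩ i
      have := h i
      omega
    · intro h
      exact ⟨fun i => by have := h i; omega, fun i => by have := h i; omega⟩
  have h2 : ((box d L).filter (Interior L)).card = (2 * L - 2) ^ d := by
    rw [h1, Fintype.card_piFinset]
    simp only [Int.card_Icc, Finset.prod_const, Finset.card_univ, Fintype.card_fin]
    congr 1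
    omega
  have h3 := Finset.card_filter_add_card_filter_not (s := box d L) (Interior L)
  rw [h2, card_box] at h3
  have h4 : (((2 * L - 2) ^ d + (bdry d L).card : ℕ) : ℝ) = ((2 * L) ^ d : ℕ) := by
    exact_mod_cast h3
  push_cast [Nat.cast_sub (show 2 ≤ 2 * L by omega)] at h4
  linarith

/-- The surface-to-volume ratio, by which all boundary errors are controlled. -/
theorem tendsto_card_bdry_div (d : ℕ) :
    Tendsto (fun L => ((bdry d L).card : ℝ) / (2 * L : ℝ) ^ d) atTop (𝓝 0) := by
  have h1 : Tendsto (fun L : ℕ => 1 - (1 - 1 / (L : ℝ)) ^ d) atTop (𝓝 0) := by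
    have := (((tendsto_one_div_atTop_nhds_zero_nat (𝕜 := ℝ)).const_sub 1).pow d).const_sub 1
    simpa using this
  refine tendsto_of_tendsto_of_tendsto_of_le_of_le' tendsto_const_nhds h1
    (Eventually.of_forall fun L => by positivity) ?_
  filter_upwards [eventually_ge_atTop 1] with L hL
  have hL' : (0 : ℝ) < L := by exact_mod_cast hL
  rw [div_le_iff₀ (by positivity), sub_mul, ← mul_pow]
  refine (card_bdry_le d hL).trans (le_of_eq ?_)
  rw [one_mul]
  congr 2
  field_simp

/-! ### Sums over nearest-neighbour pairs -/

/-- The right-hand side does not mention the box. Pairs starting in G see their true neighbours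
because G is interior; the other pairs that contribute start outside G and end in G, and are
enumerated by symmetry from their endpoint. -/
theorem sum_perAdj_of_support {M : Type*} [AddCommMonoid M] {F : Site d → Site d → M}
    {G : Finset (Site d)} (hF : ∀ x y, x ∉ G → y ∉ G → F x y = 0) {L : ℕ}
    (hG : ∀ x ∈ G, Interior L x) :
    ∑ x ∈ box d L, ∑ y ∈ (box d L).filter (PerAdj L x), F x y =
      ∑ x ∈ G, ∑ y ∈ nbrs x, F x y + ∑ y ∈ G, ∑ x ∈ nbrs y \ G, F x y := by
  have hsub : G ⊆ box d L := fun x hx => mem_box.2 fun i => by have := hG x hx i; omega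
  rw [← Finset.sum_sdiff hsub, add_comm]
  congr 1
  · exact Finset.sum_congr rfl fun x hx => by rw [filter_perAdj_of_interior (hG x hx)]
  · have h1 : ∀ x ∈ box d L \ G, ∑ y ∈ (box d L).filter (PerAdj L x), F x y
        = ∑ y ∈ G, if PerAdj L x y then F x y else 0 := by
      intro x hx
      rw [Finset.sum_filter]
      symm
      refine Finset.sum_subset hsub fun y _ hy => ?_
      rw [hF x y (Finset.mem_sdiff.1 hx).2 hy, ite_self]
    rw [Finset.sum_congr rfl h1, Finset.sum_comm]
    refine Finset.sum_congr rfl fun y hy => ?_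
    rw [← Finset.sum_filter]
    refine Finset.sum_congr ?_ fun _ _ => rfl
    rw [← filter_perAdj_of_interior (hG y hy)]
    ext x
    simp only [Finset.mem_filter, Finset.mem_sdiff]
    constructor
    · rintro ⟨⟨h1, h2⟩, h3⟩
      exact ⟨⟨h1, perAdj_symm h3⟩, h2⟩
    · rintro ⟨⟨h1, h3⟩, h2⟩
      exact ⟨⟨h1, h2⟩, perAdj_symm h3⟩

theorem abs_sum_le_of_card {s : Finset (Site d)} {f : Site d → ℝ} {c : ℝ} {k : ℕ}
    (hs : s.card ≤ k) (hc : 0 ≤ c) (hf : ∀ x, |f x| ≤ c) : |∑ x ∈ s, f x| ≤ k * c := by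
  refine (Finset.abs_sum_le_sum_abs _ _).trans ((Finset.sum_le_card_nsmul _ _ c
    fun x _ => hf x).trans ?_)
  rw [nsmul_eq_mul]
  gcongr

/-- Interior sites contribute equally to both sums; each boundary site costs at most 3^d terms in
either one. -/
theorem abs_sum_perAdj_sub_sum_nbrs_le {F : Site d → Site d → ℝ} {c : ℝ} (hc : 0 ≤ c)
    (hF : ∀ x y, |F x y| ≤ c) (L : ℕ) :
    |∑ x ∈ box d L, ∑ y ∈ (box d L).filter (PerAdj L x), F x y -
      ∑ x ∈ box d L, ∑ y ∈ nbrs x, F x y| ≤ (2 * 3 ^ d * c) * (bdry d L).card := by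
  rw [← Finset.sum_sub_distrib, ← Finset.sum_filter_add_sum_filter_not _ (Interior L)]
  rw [Finset.sum_eq_zero, zero_add]
  · refine (Finset.abs_sum_le_sum_abs _ _).trans ((Finset.sum_le_card_nsmul _ _
      (2 * 3 ^ d * c) fun x _ => ?_).trans ?_)
    · have h1 := abs_sum_le_of_card (card_filter_perAdj_le L x) hc (hF x)
      have h2 := abs_sum_le_of_card (card_nbrs_le x) hc (hF x)
      push_cast at h1 h2
      refine (abs_sub _ _).trans ?_
      linarith
    · rw [nsmul_eq_mul, mul_comm]
      exact le_rfl
  · intro x hx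
    rw [filter_perAdj_of_interior (Finset.mem_filter.1 hx).2, sub_self]

/-- Passing to the larger box unwraps the periodic bonds, which costs 2 * 3^d terms per boundary
site, and adds the pairs entering the small box from outside, at most 3^d more. -/
theorem abs_sum_perAdj_sub_le {F : Site d → Site d → ℝ} {c : ℝ} (hc : 0 ≤ c)
    (hF : ∀ x y, |F x y| ≤ c) {L L' : ℕ} (hL : L < L')
    (h0 : ∀ x y, x ∉ box d L → y ∉ box d L → F x y = 0) :
    |∑ x ∈ box d L', ∑ y ∈ (box d L').filter (PerAdj L' x), F x y -
      ∑ x ∈ box d L, ∑ y ∈ (box d L).filter (PerAdj L x), F x y| ≤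
      (3 * 3 ^ d * c) * (bdry d L).card := by
  rw [sum_perAdj_of_support h0 fun x hx => interior_of_mem_box hL hx]
  have h1 := abs_sum_perAdj_sub_sum_nbrs_le hc hF L
  have h2 : |∑ y ∈ box d L, ∑ x ∈ nbrs y \ box d L, F x y| ≤
      (3 ^ d * c) * (bdry d L).card := by
    rw [← Finset.sum_filter_add_sum_filter_not _ (Interior L), Finset.sum_eq_zero, zero_add]
    · refine (Finset.abs_sum_le_sum_abs _ _).trans ((Finset.sum_le_card_nsmul _ _
        (3 ^ d * c) fun y _ => ?_).trans ?_)
      · have := abs_sum_le_of_card ((Finset.card_le_card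
          (Finset.sdiff_subset (s := nbrs y) (t := box d L))).trans (card_nbrs_le y)) hc
          (fun x => hF x y)
        exact_mod_cast this
      · rw [nsmul_eq_mul, mul_comm]
        exact le_rfl
    · intro y hy
      rw [Finset.sdiff_eq_empty_iff_subset.2, Finset.sum_empty]
      exact fun x hx => mem_box_of_mem_nbrs (Finset.mem_filter.1 hy).2 hx
  rw [abs_sub_le_iff] at h1
  rw [abs_le] at h2 ⊢
  constructor <;> linarith [h1.1, h1.2, h2.1, h2.2]

/-! ### Sums of functions of period two -/

theorem card_filter_emod_two (L : ℕ) (b : ℤ) (hb : b = 0 ∨ b = 1) :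
    ((Finset.Icc (-(L : ℤ) + 1) L).filter fun z => z % 2 = b).card = L := by
  induction L with
  | zero => simp
  | succ L ih =>
    -- The two new points -L and L + 1 have opposite parity, so each class gains exactly one.
    have h1 : Finset.Icc (-((L + 1 : ℕ) : ℤ) + 1) ((L + 1 : ℕ) : ℤ) =
        insert (-(L : ℤ)) (insert ((L : ℤ) + 1) (Finset.Icc (-(L : ℤ) + 1) L)) := by
      ext z
      simp only [Finset.mem_Icc, Finset.mem_insert]
      omega
    rw [h1, Finset.filter_insert, Finset.filter_insert]
    split_ifs with h2 h3 h3
    · omega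
    · rw [Finset.card_insert_of_notMem, ih]
      simp
    · rw [Finset.card_insert_of_notMem, ih]
      simp
    · omega

/-- The box with L = 1 is `{0, 1}^d`, a set of representatives modulo 2, and each class meets the
large box in L^d sites. -/
theorem sum_box_of_mod_two {M : Type*} [AddCommMonoid M] {L : ℕ} {f : Site d → M}
    (h : ∀ x ∈ box d L, f x = f fun i => x i % 2) :
    ∑ x ∈ box d L, f x = L ^ d • ∑ x ∈ box d 1, f x := by
  rw [Finset.sum_congr rfl h, ← Finset.sum_fiberwise_of_maps_to (t := box d 1)
    (g := fun x i => x i % 2), Finset.smul_sum]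
  · refine Finset.sum_congr rfl fun r hr => ?_
    rw [Finset.sum_congr rfl fun x hx => by rw [(Finset.mem_filter.1 hx).2], Finset.sum_const]
    congr 1
    have : (box d L).filter (fun x => (fun i => x i % 2) = r) =
        Fintype.piFinset fun i => (Finset.Icc (-(L : ℤ) + 1) L).filter fun z => z % 2 = r i := by
      ext x
      simp only [Finset.mem_filter, box, Fintype.mem_piFinset, funext_iff, forall_and]
    rw [this, Fintype.card_piFinset]
    have hr' := mem_box.1 hr
    rw [Finset.prod_congr rfl fun i _ => card_filter_emod_two L (r i)
      (by have := hr' i; push_cast at this; omega)]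
    simp
  · intro x _
    rw [mem_box]
    intro i
    push_cast
    constructor <;> omega

theorem eq_add_emod_two (x : Site d) :
    x = (fun i => x i % 2) + (2 : ℕ) • fun i => x i / 2 := by
  funext i
  simp only [Pi.add_apply, Pi.smul_apply, Int.nsmul_eq_mul]
  omega

theorem emod_two_mem_box {L : ℕ} (hL : 1 ≤ L) (x : Site d) : (fun i => x i % 2) ∈ box d L := by
  rw [mem_box]
  intro i
  constructor <;> omega

theorem sgn_congr {x y : Site d} (h : ∀ i, x i ≡ y i [ZMOD 2]) : sgn x = sgn y := by
  have h1 : ∑ i, x i ≡ ∑ i, y i [ZMOD 2] := Int.ModEq.sum fun i _ => h i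
  obtain ⟨k, hk⟩ := h1.symm.dvd
  have : ∑ i, x i = ∑ i, y i + 2 * k := by omega
  rw [sgn, this, zpow_add₀ (by norm_num), zpow_mul]
  simp [sgn]

end Lattice

/-! ### Ground vectors of Hermitian matrices -/

section GroundVector

/-- Induction on the dimension of V: if some T i is not scalar on V, intersect V with one of its
eigenspaces. This is strictly smaller and, by commutation, still invariant. No finiteness of the
family is needed. -/
theorem exists_common_eigenvector {κ W : Type*} [AddCommGroup W] [Module ℂ W]
    [FiniteDimensional ℂ W] {T : κ → Module.End ℂ W} (hc : ∀ i j, Commute (T i) (T j))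
    (V : Submodule ℂ W) (hV : V ≠ ⊥) (hT : ∀ i, ∀ x ∈ V, T i x ∈ V) :
    ∃ x ∈ V, x ≠ 0 ∧ ∀ i, ∃ c : ℂ, T i x = c • x := by
  induction h : Module.finrank ℂ V using Nat.strong_induction_on generalizing V with
  | _ k ih =>
    by_cases hs : ∀ i, ∃ c : ℂ, ∀ x ∈ V, T i x = c • x
    · obtain ⟨x, hx, h0⟩ := V.ne_bot_iff.1 hV
      exact ⟨x, hx, h0, fun i => (hs i).imp fun c hc => hc x hx⟩
    · push Not at hs
      obtain ⟨i, hi⟩ := hs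
      have : Nontrivial V := Submodule.nontrivial_iff_ne_bot.2 hV
      obtain ⟨c, hc'⟩ := Module.End.exists_eigenvalue ((T i).restrict (hT i))
      obtain ⟨y, hy⟩ := hc'.exists_hasEigenvector
      have hy1 : T i y = c • (y : W) := congrArg Subtype.val hy.apply_eq_smul
      have hne : V ⊓ Module.End.eigenspace (T i) c ≠ ⊥ := by
        refine (Submodule.ne_bot_iff _).2 ⟨y, ⟨y.2, Module.End.mem_eigenspace_iff.2 hy1⟩, ?_⟩
        exact fun e => hy.2 (Subtype.ext e)
      have hlt : V ⊓ Module.End.eigenspace (T i) c < V := by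
        refine lt_of_le_of_ne inf_le_left fun e => ?_
        obtain ⟨x, hx, hx'⟩ := hi c
        rw [← e] at hx
        exact hx' (Module.End.mem_eigenspace_iff.1 hx.2)
      obtain ⟨x, hx, h0⟩ := ih _ (h ▸ Submodule.finrank_lt_finrank_of_lt hlt) _ hne
        (fun j x hx => ⟨hT j x hx.1, Module.End.mem_eigenspace_iff.2 (by
          have h1 := LinearMap.congr_fun (hc i j).eq x
          simp only [Module.End.mul_apply] at h1
          rw [h1, Module.End.mem_eigenspace_iff.1 hx.2, map_smul])⟩) rfl
      exact ⟨x, hx.1, h0⟩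

variable {ι : Type*} [Fintype ι]

theorem star_dotProduct_self (Φ : ι → ℂ) : star Φ ⬝ᵥ Φ = ((∑ i, ‖Φ i‖ ^ 2 : ℝ) : ℂ) := by
  simp only [dotProduct, Pi.star_apply, RCLike.star_def, Complex.conj_mul']
  push_cast; rfl

theorem expect_sub (Φ : ι → ℂ) (A B : Matrix ι ι ℂ) :
    expect Φ (A - B) = expect Φ A - expect Φ B := by
  simp [expect, Matrix.sub_mulVec]

theorem expect_smul (Φ : ι → ℂ) (c : ℂ) (A : Matrix ι ι ℂ) :
    expect Φ (c • A) = c * expect Φ A := by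
  simp [expect, Matrix.smul_mulVec]

theorem expect_star_mul_self (Φ : ι → ℂ) (A : Matrix ι ι ℂ) :
    ∃ r : ℝ, 0 ≤ r ∧ expect Φ (star A * A) = r := by
  refine ⟨∑ i, ‖A.mulVec Φ i‖ ^ 2, by positivity, ?_⟩
  rw [expect, ← Matrix.mulVec_mulVec, Matrix.dotProduct_mulVec, Matrix.star_eq_conjTranspose,
    ← Matrix.star_mulVec, star_dotProduct_self]

variable [DecidableEq ι]

theorem exists_least_eigenvalue [Nonempty ι] {H : Matrix ι ι ℂ} (hH : H.IsHermitian) :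
    ∃ E : ℝ, IsLeast {E : ℝ | ∃ Ψ : ι → ℂ, Ψ ≠ 0 ∧ H.mulVec Ψ = (E : ℂ) • Ψ} E := by
  have hfin : {E : ℝ | ∃ Ψ : ι → ℂ, Ψ ≠ 0 ∧ H.mulVec Ψ = (E : ℂ) • Ψ}.Finite := by
    refine ((Module.End.finite_hasEigenvalue (Matrix.toLin' H)).preimage
      (f := ((↑) : ℝ → ℂ)) Complex.ofReal_injective.injOn).subset ?_
    rintro E ⟨Ψ, h0, h⟩
    exact Module.End.hasEigenvalue_of_hasEigenvector
      ⟨Module.End.mem_eigenspace_iff.2 (by simpa using h), h0⟩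
  obtain ⟨i⟩ := ‹Nonempty ι›
  have hne : {E : ℝ | ∃ Ψ : ι → ℂ, Ψ ≠ 0 ∧ H.mulVec Ψ = (E : ℂ) • Ψ}.Nonempty := by
    refine ⟨hH.eigenvalues i, hH.eigenvectorBasis i, ?_, ?_⟩
    · intro e
      have := hH.eigenvectorBasis.orthonormal.ne_zero i
      exact this (WithLp.ofLp_injective _ e)
    · exact hH.mulVec_eigenvectorBasis i
  obtain ⟨E, hE, hmin⟩ := Set.exists_min_image _ id hfin hne
  exact ⟨E, hE, fun E' h => hmin E' h⟩

/-- The permutations preserve the lowest eigenspace, so a common eigenvector exists there; since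
they preserve the norm, its eigenvalues are phases. -/
theorem exists_groundVector [Nonempty ι] {κ : Type*} {H : Matrix ι ι ℂ} (hH : H.IsHermitian)
    (e : κ → Equiv.Perm ι) (he : ∀ u v, Commute (e u) (e v))
    (hHe : ∀ v, H.submatrix (e v) (e v) = H) :
    ∃ Φ : ι → ℂ, IsGroundVector H Φ ∧ ∀ v, ∃ c : ℂ, ‖c‖ = 1 ∧ ∀ σ, Φ (e v σ) = c * Φ σ := by
  obtain ⟨E, ⟨Ψ₀, h0, h1⟩, hmin⟩ := exists_least_eigenvalue hH
  obtain ⟨Ψ, hΨ, hΨ0, hc⟩ := exists_common_eigenvector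
    (T := fun v => LinearMap.funLeft ℂ ℂ (e v)) (fun u v => by
      refine LinearMap.ext fun f => funext fun σ => ?_
      have := congrArg (fun p : Equiv.Perm ι => f (p σ)) (he u v).eq
      simpa [LinearMap.funLeft] using this.symm)
    (Module.End.eigenspace (Matrix.toLin' H) (E : ℂ))
    ((Submodule.ne_bot_iff _).2 ⟨Ψ₀, Module.End.mem_eigenspace_iff.2 (by simpa using h1), h0⟩)
    (fun v f hf => by
      rw [Module.End.mem_eigenspace_iff, Matrix.toLin'_apply] at hf ⊢
      funext σ
      have h2 := congrFun hf (e v σ)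
      conv_lhs => rw [← hHe v]
      simp only [Matrix.mulVec, dotProduct, Matrix.submatrix_apply, LinearMap.funLeft_apply,
        Pi.smul_apply] at h2 ⊢
      rw [← h2]
      exact Equiv.sum_comp (e v) fun τ => H (e v σ) τ * f τ)
  rw [Module.End.mem_eigenspace_iff, Matrix.toLin'_apply] at hΨ
  have hpos : 0 < ∑ i, ‖Ψ i‖ ^ 2 := by
    obtain ⟨i, hi⟩ := Function.ne_iff.1 hΨ0
    have : 0 < ‖Ψ i‖ := norm_pos_iff.2 hi
    exact Finset.sum_pos' (fun _ _ => by positivity) ⟨i, Finset.mem_univ i, by positivity⟩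
  refine ⟨((Real.sqrt (∑ i, ‖Ψ i‖ ^ 2))⁻¹ : ℂ) • Ψ, ⟨?_, E, ?_, fun E' Ψ' h h' => hmin ⟨Ψ', h, h'⟩⟩,
    fun v => ?_⟩
  · rw [star_dotProduct_self]
    simp only [Pi.smul_apply, norm_smul, mul_pow, ← Finset.mul_sum]
    rw [norm_inv, Complex.norm_real, Real.norm_eq_abs, inv_pow, sq_abs, Real.sq_sqrt hpos.le,
      inv_mul_cancel₀ hpos.ne', Complex.ofReal_one]
  · rw [Matrix.mulVec_smul, hΨ, smul_comm]
  · obtain ⟨c, hc⟩ := hc v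
    have hc' : ∀ σ, Ψ (e v σ) = c * Ψ σ := fun σ => congrFun hc σ
    refine ⟨c, ?_, fun σ => ?_⟩
    · have h3 := Equiv.sum_comp (e v) fun σ => ‖Ψ σ‖ ^ 2
      simp only [hc', norm_mul, mul_pow, ← Finset.mul_sum] at h3
      have h4 : ‖c‖ ^ 2 = 1 := mul_right_cancel₀ hpos.ne' (by rw [h3, one_mul])
      nlinarith [norm_nonneg c]
    · simp only [Pi.smul_apply, hc', smul_eq_mul]
      ring

-- The eigenvalues of H - E are nonnegative because E is the lowest one of H. The form C*C keeps
-- this positivity usable in every state of the quasi-local algebra.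
open scoped ComplexOrder MatrixOrder Matrix.Norms.L2Operator in
theorem IsGroundVector.exists_sub_eq {H : Matrix ι ι ℂ} (hH : H.IsHermitian) {Φ : ι → ℂ}
    (h : IsGroundVector H Φ) :
    ∃ E : ℝ, H.mulVec Φ = (E : ℂ) • Φ ∧ ∃ C : Matrix ι ι ℂ, H - (E : ℂ) • 1 = star C * C := by
  obtain ⟨E, hE, hmin⟩ := h.2
  refine ⟨E, hE, ?_⟩
  have hM : (H - (E : ℂ) • (1 : Matrix ι ι ℂ)).IsHermitian :=
    hH.sub (by simp [Matrix.IsHermitian, Matrix.conjTranspose_smul])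
  have hpsd : (H - (E : ℂ) • (1 : Matrix ι ι ℂ)).PosSemidef := by
    rw [hM.posSemidef_iff_eigenvalues_nonneg]
    intro i
    have h1 := hM.mulVec_eigenvectorBasis i
    rw [Matrix.sub_mulVec, Matrix.smul_mulVec, Matrix.one_mulVec, sub_eq_iff_eq_add] at h1
    have h2 := hmin (hM.eigenvalues i + E) (hM.eigenvectorBasis i) (fun e =>
      hM.eigenvectorBasis.orthonormal.ne_zero i (WithLp.ofLp_injective _ e)) (by
        rw [h1, Complex.ofReal_add, add_smul]
        rfl)
    simpa using h2
  obtain ⟨C, hC⟩ := CStarAlgebra.nonneg_iff_eq_star_mul_self.mp hpsd.nonneg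
  exact ⟨C, hC⟩

/-- Ground vectors satisfy the ground-state inequality. -/
theorem IsGroundVector.expect_commutator {H : Matrix ι ι ℂ} (hH : H.IsHermitian) {Φ : ι → ℂ}
    (h : IsGroundVector H Φ) (A : Matrix ι ι ℂ) :
    ∃ r : ℝ, 0 ≤ r ∧ expect Φ (star A * (H * A - A * H)) = r := by
  -- Since HΦ = EΦ, the expectation is ⟨AΦ, (H - E)AΦ⟩ = ‖CAΦ‖².
  obtain ⟨E, hE, C, hC⟩ := h.exists_sub_eq hH
  obtain ⟨r, hr, e⟩ := expect_star_mul_self Φ (C * A)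
  refine ⟨r, hr, ?_⟩
  have h1 : expect Φ (star A * (A * H)) = E * expect Φ (star A * A) := by
    rw [expect, expect, ← mul_assoc, ← Matrix.mulVec_mulVec, hE, Matrix.mulVec_smul,
      dotProduct_smul, smul_eq_mul]
  have h2 : star (C * A) * (C * A) = star A * (H * A) - (E : ℂ) • (star A * A) := by
    rw [star_mul, mul_assoc, ← mul_assoc (star C), ← hC, sub_mul, mul_sub, smul_mul_assoc, one_mul,
      mul_smul_comm]
  rw [← e, h2, mul_sub, expect_sub, expect_sub, h1, expect_smul]

end GroundVector

/-! ### The Hamiltonian and its symmetries -/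

section Symmetry

variable {d n : ℕ}

theorem isHermitian_hamZero (L : ℕ) : (hamZero d n L).IsHermitian := by
  change star _ = _
  simp only [hamZero, star_smul, star_sum]
  rw [Finset.sum_comm]
  congr 1
  · simp
  refine Finset.sum_congr rfl fun x _ => Finset.sum_congr rfl fun y _ => ?_
  by_cases h : PerAdj L (x : Site d) y
  · rw [if_pos h, if_pos (perAdj_symm h), star_sum]
    simp only [star_mul, star_spinAt]
  · rw [if_neg h, if_neg fun h' => h (perAdj_symm h'), star_zero]

theorem isHermitian_ham (L : ℕ) (B : ℝ) : (ham d n L B).IsHermitian := by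
  refine (isHermitian_hamZero L).sub ?_
  change star _ = _
  simp only [stag, star_smul, star_sum, star_spinAt]
  congr 1
  · simp
  · refine Finset.sum_congr rfl fun x _ => ?_
    congr 1
    simp

variable {L : ℕ}

/-- The action of a translation by `2v` on the configurations of the periodic box. -/
def confPerm (n : ℕ) (hL : 1 ≤ L) (v : Site d) : Equiv.Perm (LocConf n (box d L)) :=
  Equiv.arrowCongr (boxPerm hL v).symm (Equiv.refl _)

theorem confPerm_apply (hL : 1 ≤ L) (v : Site d) (σ : LocConf n (box d L)) (x : box d L) :
    confPerm n hL v σ x = σ (boxPerm hL v x) := rfl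

/-- The action of a translation by `2v` on the observables of the periodic box. -/
def matPerm (n : ℕ) (hL : 1 ≤ L) (v : Site d) : LocMat n (box d L) ≃ₐ[ℂ] LocMat n (box d L) :=
  Matrix.reindexAlgEquiv ℂ ℂ (confPerm n hL v).symm

theorem matPerm_apply (hL : 1 ≤ L) (v : Site d) (A : LocMat n (box d L)) :
    matPerm n hL v A = A.submatrix (confPerm n hL v) (confPerm n hL v) := rfl

theorem matPerm_spinAt (hL : 1 ≤ L) (v : Site d) (j : Fin 3) (x : box d L) :
    matPerm n hL v (spinAt j x) = spinAt j (boxPerm hL v x) := by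
  ext σ τ
  simp only [matPerm_apply, Matrix.submatrix_apply, spinAt, Matrix.of_apply, confPerm_apply]
  refine if_congr ⟨fun h y hy => ?_, fun h y hy => h _ fun e => hy (Equiv.injective _ e)⟩ rfl rfl
  have := h ((boxPerm hL v).symm y) fun e => hy (by rw [← e, Equiv.apply_symm_apply])
  simpa using this

theorem matPerm_hamZero (hL : 1 ≤ L) (v : Site d) :
    matPerm n hL v (hamZero d n L) = hamZero d n L := by
  simp only [hamZero, map_smul, map_sum]
  congr 1
  conv_rhs => rw [← Equiv.sum_comp (boxPerm hL v)]
  refine Finset.sum_congr rfl fun x _ => ?_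
  conv_rhs => rw [← Equiv.sum_comp (boxPerm hL v)]
  refine Finset.sum_congr rfl fun y _ => ?_
  have h : PerAdj L (boxPerm hL v x : Site d) (boxPerm hL v y) ↔ PerAdj L (x : Site d) y :=
    perAdj_boxShift hL v x.2 y.2
  by_cases hxy : PerAdj L (x : Site d) y
  · rw [if_pos hxy, if_pos (h.2 hxy), map_sum]
    simp only [map_mul, matPerm_spinAt]
  · rw [if_neg hxy, if_neg (h.not.2 hxy), map_zero]

theorem sgn_boxShift (L : ℕ) (v x : Site d) : sgn (boxShift L v x) = sgn x := by
  refine sgn_congr fun i => ?_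
  refine ((boxShift_modEq L v x i).of_mul_right _).trans ?_
  simp [Int.ModEq]

theorem matPerm_stag (hL : 1 ≤ L) (v : Site d) :
    matPerm n hL v (stag d n L) = stag d n L := by
  simp only [stag, map_smul, map_sum, matPerm_spinAt]
  conv_rhs => rw [← Equiv.sum_comp (boxPerm hL v)]
  refine Finset.sum_congr rfl fun x _ => ?_
  congr 1
  exact (sgn_boxShift L v x).symm

theorem confPerm_commute (hL : 1 ≤ L) (u v : Site d) :
    Commute (confPerm n hL u) (confPerm n hL v) := by
  refine Equiv.ext fun σ => funext fun x => ?_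
  simp only [Equiv.Perm.mul_apply, confPerm_apply]
  congr 1
  refine Subtype.ext ?_
  change boxShift L v (boxShift L u x) = boxShift L u (boxShift L v x)
  rw [boxShift_boxShift hL, boxShift_boxShift hL, add_comm]

theorem isPeriodTwoVector_iff (hL : 1 ≤ L) {Φ : LocConf n (box d L) → ℂ} :
    IsPeriodTwoVector Φ ↔
      ∀ v, ∃ c : ℂ, ‖c‖ = 1 ∧ ∀ σ, Φ σ = c * Φ (confPerm n hL v σ) := by
  refine forall_congr' fun v => exists_congr fun c => and_congr_right fun _ => ?_
  constructor
  · intro h τ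
    refine h _ _ fun x y hxy => ?_
    rw [confPerm_apply]
    congr 1
    exact Subtype.ext (eq_boxShift hL x.2 hxy)
  · intro h σ τ hστ
    have : σ = confPerm n hL v τ := by
      funext y
      rw [confPerm_apply, hστ (boxPerm hL v y) y fun i => boxShift_modEq L v y i]
    rw [h τ, this]

theorem exists_groundVector_ham (hL : 1 ≤ L) (B : ℝ) :
    ∃ Φ : LocConf n (box d L) → ℂ, IsGroundVector (ham d n L B) Φ ∧ IsPeriodTwoVector Φ := by
  obtain ⟨Φ, h1, h2⟩ := exists_groundVector (isHermitian_ham (d := d) (n := n) L B)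
    (confPerm n hL) (confPerm_commute hL) fun v => by
      rw [← matPerm_apply, ham, map_sub, map_smul, matPerm_hamZero, matPerm_stag]
  refine ⟨Φ, h1, (isPeriodTwoVector_iff hL).2 fun v => ?_⟩
  obtain ⟨c, hc, h⟩ := h2 v
  have h0 : c ≠ 0 := by rintro rfl; simp at hc
  refine ⟨c⁻¹, by simp [hc], fun σ => ?_⟩
  rw [h, inv_mul_cancel_left₀ h0]

/-- The phase c of the translated vector cancels against its conjugate. -/
theorem expect_matPerm (hL : 1 ≤ L) {Φ : LocConf n (box d L) → ℂ} (h : IsPeriodTwoVector Φ)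
    (v : Site d) (A : LocMat n (box d L)) : expect Φ (matPerm n hL v A) = expect Φ A := by
  obtain ⟨c, hc, h⟩ := (isPeriodTwoVector_iff hL).1 h v
  have hc' : star c * c = 1 := by
    rw [RCLike.star_def, Complex.conj_mul', hc]; simp
  simp only [expect, dotProduct, Matrix.mulVec, matPerm_apply, Matrix.submatrix_apply,
    Pi.star_apply]
  rw [← Equiv.sum_comp (confPerm n hL v) fun σ => star (Φ σ) * ∑ τ, A σ τ * Φ τ]
  refine Finset.sum_congr rfl fun σ _ => ?_
  rw [← Equiv.sum_comp (confPerm n hL v) fun τ => A _ τ * Φ τ, h σ, Finset.mul_sum, Finset.mul_sum]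
  refine Finset.sum_congr rfl fun τ _ => ?_
  rw [h τ, star_mul']
  linear_combination (star (Φ (confPerm n hL v σ)) *
    A (confPerm n hL v σ) (confPerm n hL v τ) * Φ (confPerm n hL v τ)) * hc'

theorem vecState_spinQ_boxShift (hL : 1 ≤ L) {Φ : LocConf n (box d L) → ℂ}
    (h : IsPeriodTwoVector Φ) (v : Site d) (j : Fin 3) {x : Site d} (hx : x ∈ box d L) :
    vecState Φ (spinQ n j (boxShift L v x)) = vecState Φ (spinQ n j x) := by
  have h1 := expect_matPerm hL h v (spinAt j ⟨x, hx⟩)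
  rwa [matPerm_spinAt, ← vecState_ql, ← vecState_ql, ql_spinAt, ql_spinAt] at h1

theorem vecState_bond_boxShift (hL : 1 ≤ L) {Φ : LocConf n (box d L) → ℂ}
    (h : IsPeriodTwoVector Φ) (v : Site d) {x y : Site d} (hx : x ∈ box d L)
    (hy : y ∈ box d L) :
    vecState Φ (bond n (boxShift L v x) (boxShift L v y)) = vecState Φ (bond n x y) := by
  have h1 := expect_matPerm hL h v
    (∑ j : Fin 3, spinAt (n := n) j ⟨x, hx⟩ * spinAt j ⟨y, hy⟩)
  simp only [map_sum, map_mul, matPerm_spinAt] at h1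
  rwa [← vecState_ql, ← vecState_ql, ql_bond, ql_bond] at h1

end Symmetry

/-! ### Energy and magnetization of states of period two -/

section PeriodTwo

variable {d n : ℕ}

theorem shiftMat_mul (v : Site d) {Γ : Finset (Site d)} (A B : LocMat n Γ) :
    shiftMat v (A * B) = shiftMat v A * shiftMat v B := by
  refine (Matrix.submatrix_mul A B _ _ _ ⟨fun σ τ h => ?_, fun σ => ?_⟩)
  · funext x
    obtain ⟨y, hy, e⟩ := Finset.mem_map.1 x.2
    have e' : x = ⟨y + v, Finset.mem_map_of_mem (addRightEmbedding v) hy⟩ := Subtype.ext e.symm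
    rw [e']
    exact congrFun h ⟨y, hy⟩
  · refine ⟨fun x => σ ⟨x - v, ?_⟩, ?_⟩
    · obtain ⟨y, hy, e⟩ := Finset.mem_map.1 x.2
      rw [← e]
      simpa using hy
    · funext x
      simp

theorem shiftMat_sum {ι : Type*} (s : Finset ι) (v : Site d) {Γ : Finset (Site d)}
    (A : ι → LocMat n Γ) : shiftMat v (∑ i ∈ s, A i) = ∑ i ∈ s, shiftMat v (A i) := by
  ext σ τ
  simp [shiftMat, Matrix.sum_apply]

theorem shiftMat_spinAt (v : Site d) {Γ : Finset (Site d)} (j : Fin 3) (x : Γ) :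
    shiftMat v (spinAt (n := n) j x) =
      spinAt j ⟨(x : Site d) + v, Finset.mem_map_of_mem (addRightEmbedding v) x.2⟩ := by
  ext σ τ
  simp only [shiftMat, Matrix.submatrix_apply, spinAt, Matrix.of_apply]
  refine if_congr ⟨fun h y hy => ?_, fun h y hy => h _ fun e => hy ?_⟩ rfl rfl
  · obtain ⟨z, hz, e⟩ := Finset.mem_map.1 y.2
    have e' : y = ⟨z + v, Finset.mem_map_of_mem (addRightEmbedding v) hz⟩ := Subtype.ext e.symm
    rw [e']
    exact h ⟨z, hz⟩ fun e2 => hy (by rw [e', ← e2])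
  · exact Subtype.ext (add_right_cancel (congrArg Subtype.val e))

variable {ω : QL d n →ₗ[ℂ] ℂ}

theorem IsPeriodTwo.spinQ_add (h : IsPeriodTwo ω) (j : Fin 3) (v x : Site d) :
    ω (spinQ n j (x + 2 • v)) = ω (spinQ n j x) := by
  have h1 := h v {x} (spinAt j ⟨x, Finset.mem_singleton_self x⟩)
  rwa [shiftMat_spinAt, ql_spinAt, ql_spinAt] at h1

theorem IsPeriodTwo.bond_add (h : IsPeriodTwo ω) (v x y : Site d) :
    ω (bond n (x + 2 • v) (y + 2 • v)) = ω (bond n x y) := by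
  have h1 := h v {x, y} (∑ j : Fin 3, spinAt j ⟨x, by simp⟩ * spinAt j ⟨y, by simp⟩)
  simp only [shiftMat_sum, shiftMat_mul, shiftMat_spinAt] at h1
  rwa [ql_bond, ql_bond] at h1

theorem sgn_emod_two (x : Site d) : sgn (fun i => x i % 2) = sgn x :=
  sgn_congr fun _ => Int.mod_modEq _ _

theorem IsPeriodTwo.apply_stag (h : IsPeriodTwo ω) (L : ℕ) :
    ω (ql _ (stag d n L)) = L ^ d • ω (ql _ (stag d n 1)) := by
  simp only [ql_stag, map_sum, map_smul]
  refine sum_box_of_mod_two fun x _ => ?_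
  rw [sgn_emod_two]
  congr 1
  conv_lhs => rw [eq_add_emod_two x]
  exact h.spinQ_add _ _ _

theorem eq_boxShift_emod_two {L : ℕ} (hL : 1 ≤ L) {x : Site d} (hx : x ∈ box d L) :
    x = boxShift L (fun i => x i / 2) fun i => x i % 2 :=
  eq_boxShift hL hx fun i => modEq_of_eq (by omega)

theorem IsPeriodTwoVector.apply_stag {L : ℕ} (hL : 1 ≤ L) {Φ : LocConf n (box d L) → ℂ}
    (h : IsPeriodTwoVector Φ) :
    vecState Φ (ql _ (stag d n L)) = L ^ d • vecState Φ (ql _ (stag d n 1)) := by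
  simp only [ql_stag, map_sum, map_smul]
  refine sum_box_of_mod_two fun x hx => ?_
  rw [sgn_emod_two]
  congr 1
  conv_lhs => rw [eq_boxShift_emod_two hL hx]
  exact vecState_spinQ_boxShift hL h _ _ (emod_two_mem_box hL x)

theorem magIn_vecState {L : ℕ} (Φ : LocConf n (box d L) → ℂ) :
    magIn (vecState Φ) L = magVec Φ := by
  rw [magIn, vecState_ql, magVec]

theorem magIn_eq_of_apply_stag {L : ℕ} (hL : 1 ≤ L)
    (h : ω (ql _ (stag d n L)) = L ^ d • ω (ql _ (stag d n 1))) : magIn ω L = magIn ω 1 := by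
  have : (0 : ℝ) < L := by exact_mod_cast hL
  rw [magIn, magIn, h, card_box, card_box, nsmul_eq_mul]
  push_cast
  rw [← Complex.ofReal_natCast, ← Complex.ofReal_pow, Complex.re_ofReal_mul, mul_pow]
  field_simp

theorem IsPeriodTwo.magIn_eq (h : IsPeriodTwo ω) {L : ℕ} (hL : 1 ≤ L) :
    magIn ω L = magIn ω 1 := magIn_eq_of_apply_stag hL (h.apply_stag L)

theorem IsPeriodTwoVector.magVec_eq {L : ℕ} (hL : 1 ≤ L) {Φ : LocConf n (box d L) → ℂ}
    (h : IsPeriodTwoVector Φ) : magVec Φ = magIn (vecState Φ) 1 := by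
  rw [← magIn_vecState, magIn_eq_of_apply_stag hL (h.apply_stag hL)]

/-- The exchange energy of the cell `{0, 1}^d`. -/
def cellZero (d n : ℕ) : QL d n := (1 / 2 : ℂ) • ∑ x ∈ box d 1, ∑ y ∈ nbrs x, bond n x y

/-- The energy of the cell `{0, 1}^d` in the staggered field `B`. -/
def cell (d n : ℕ) (B : ℝ) : QL d n := cellZero d n - (B : ℂ) • ql _ (stag d n 1)

theorem IsPeriodTwo.sum_nbrs (h : IsPeriodTwo ω) (L : ℕ) :
    ∑ x ∈ box d L, ∑ y ∈ nbrs x, ω (bond n x y) =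
      L ^ d • ∑ x ∈ box d 1, ∑ y ∈ nbrs x, ω (bond n x y) := by
  refine sum_box_of_mod_two fun x _ => ?_
  set v : Site d := fun i => x i / 2
  set r : Site d := fun i => x i % 2
  have hx : x = r + 2 • v := eq_add_emod_two x
  symm
  refine Finset.sum_bij (fun y _ => y + 2 • v) (fun y hy => ?_) (fun y _ z _ e => by simpa using e)
    (fun y hy => ⟨y - 2 • v, ?_, by simp⟩) fun y _ => ?_
  · rw [hx]; exact add_mem_nbrs.2 hy
  · rw [hx] at hy
    refine (add_mem_nbrs (v := 2 • v)).1 ?_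
    rwa [sub_add_cancel]
  · rw [hx]; exact (h.bond_add v r y).symm

/-- A state of the infinite lattice is not invariant under wrapping around the box, so the bonds
closing the torus have to be traded for true neighbours at the boundary. -/
theorem IsPeriodTwo.abs_hamZero_sub_le (h : IsPeriodTwo ω) (hω : IsState ω) (L : ℕ) :
    |(ω (ql _ (hamZero d n L))).re - L ^ d * (ω (cellZero d n)).re| ≤
      (3 ^ d * (3 * spinBound n ^ 2)) * (bdry d L).card := by
  have h1 := abs_sum_perAdj_sub_sum_nbrs_le (F := fun x y => (ω (bond n x y)).re)
    (c := 3 * spinBound n ^ 2) (by positivity)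
    (fun x y => (hω.abs_re_le_norm _).trans (norm_bond_le x y)) L
  have h2 := congrArg Complex.re (h.sum_nbrs L)
  have e1 : (ω (ql _ (hamZero d n L))).re = 1 / 2 *
      ∑ x ∈ box d L, ∑ y ∈ (box d L).filter (PerAdj L x), (ω (bond n x y)).re := by
    simp [ql_hamZero]
  have e2 : (ω (cellZero d n)).re = 1 / 2 *
      ∑ x ∈ box d 1, ∑ y ∈ nbrs x, (ω (bond n x y)).re := by
    simp [cellZero]
  simp only [nsmul_eq_mul] at h2
  push_cast at h2
  rw [← Complex.ofReal_natCast, ← Complex.ofReal_pow, Complex.re_ofReal_mul] at h2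
  simp only [Complex.re_sum] at h2
  rw [h2] at h1
  rw [e1, e2]
  rw [abs_le] at h1 ⊢
  constructor <;> linarith [h1.1, h1.2]

/-- Exact, without boundary term, because the vector has the symmetry of the torus. On the torus of
side 2 the two neighbours in one direction coincide, hence the requirement 2 ≤ L, which also makes
the unit cell interior. -/
theorem IsPeriodTwoVector.apply_hamZero {L : ℕ} (hL : 2 ≤ L) {Φ : LocConf n (box d L) → ℂ}
    (h : IsPeriodTwoVector Φ) :
    vecState Φ (ql _ (hamZero d n L)) = L ^ d • vecState Φ (cellZero d n) := by
  have hL1 : 1 ≤ L := by omega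
  simp only [ql_hamZero, cellZero, map_sum, map_smul]
  rw [smul_comm]
  congr 1
  rw [sum_box_of_mod_two (f := fun x => ∑ y ∈ (box d L).filter (PerAdj L x),
    vecState Φ (bond n x y))]
  · congr 1
    refine Finset.sum_congr rfl fun x hx => ?_
    rw [filter_perAdj_of_interior (interior_of_mem_box hL hx)]
  · intro x hx
    set v : Site d := fun i => x i / 2
    set r : Site d := fun i => x i % 2
    have hx' : x = boxShift L v r := eq_boxShift_emod_two hL1 hx
    have hr : r ∈ box d L := emod_two_mem_box hL1 x
    symm
    refine Finset.sum_bij (fun y _ => boxShift L v y) (fun y hy => ?_) (fun y hy z hz e => ?_)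
      (fun y hy => ⟨boxShift L (-v) y, ?_, ?_⟩) fun y hy => ?_
    · have hy := Finset.mem_filter.1 hy
      rw [hx', Finset.mem_filter]
      exact ⟨boxShift_mem hL1 _ _, (perAdj_boxShift hL1 v hr hy.1).2 hy.2⟩
    · have := congrArg (boxShift L (-v)) e
      rwa [boxShift_boxShift hL1, boxShift_boxShift hL1, neg_add_cancel,
        boxShift_zero hL1 (Finset.mem_filter.1 hy).1,
        boxShift_zero hL1 (Finset.mem_filter.1 hz).1] at this
    · have hy := Finset.mem_filter.1 hy
      rw [Finset.mem_filter]
      refine ⟨boxShift_mem hL1 _ _, ?_⟩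
      rw [← perAdj_boxShift hL1 v hr (boxShift_mem hL1 _ _), boxShift_boxShift hL1, add_neg_cancel,
        boxShift_zero hL1 hy.1, ← hx']
      exact hy.2
    · rw [boxShift_boxShift hL1, add_neg_cancel, boxShift_zero hL1 (Finset.mem_filter.1 hy).1]
    · conv_rhs => rw [hx']
      exact (vecState_bond_boxShift hL1 h v hr (Finset.mem_filter.1 hy).1).symm

theorem IsPeriodTwoVector.apply_ham {L : ℕ} (hL : 2 ≤ L) {Φ : LocConf n (box d L) → ℂ}
    (h : IsPeriodTwoVector Φ) (B : ℝ) :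
    (expect Φ (ham d n L B)).re = L ^ d * (vecState Φ (cell d n B)).re := by
  rw [← vecState_ql, ql_ham, cell, map_sub, map_sub, map_smul, map_smul, h.apply_hamZero hL,
    h.apply_stag (by omega), smul_comm, ← smul_sub, nsmul_eq_mul]
  push_cast
  rw [← Complex.ofReal_natCast, ← Complex.ofReal_pow, Complex.re_ofReal_mul]

theorem IsPeriodTwo.apply_ham_le (h : IsPeriodTwo ω) (hω : IsState ω) (L : ℕ) (B : ℝ) :
    (ω (ql _ (ham d n L B))).re ≤ L ^ d * (ω (cell d n B)).re +
      (3 ^ d * (3 * spinBound n ^ 2)) * (bdry d L).card := by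
  have h1 := h.abs_hamZero_sub_le hω L
  have h2 : (ω (ql _ (stag d n L))).re = L ^ d * (ω (ql _ (stag d n 1))).re := by
    rw [h.apply_stag L, nsmul_eq_mul]
    push_cast
    rw [← Complex.ofReal_natCast, ← Complex.ofReal_pow, Complex.re_ofReal_mul]
  rw [ql_ham, cell, map_sub, map_sub, map_smul, map_smul, smul_eq_mul, smul_eq_mul, Complex.sub_re,
    Complex.sub_re, Complex.re_ofReal_mul, Complex.re_ofReal_mul, h2]
  rw [abs_le] at h1
  linarith [h1.2]

/-- Ground vectors minimize the energy among all states. -/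
theorem IsGroundVector.expect_le {L : ℕ} {B : ℝ} {Φ : LocConf n (box d L) → ℂ}
    (h : IsGroundVector (ham d n L B) Φ) (hω : IsState ω) :
    (expect Φ (ham d n L B)).re ≤ (ω (ql _ (ham d n L B))).re := by
  obtain ⟨E, hE, C, hC⟩ := h.exists_sub_eq (isHermitian_ham L B)
  have h1 : expect Φ (ham d n L B) = E := by
    rw [expect, hE, dotProduct_smul, h.1, smul_eq_mul, mul_one]
  have h2 := hω.re_nonneg (ql _ C)
  rw [ql_eq, ← map_star, ← map_mul, ← hC, map_sub, map_smul, map_one, map_sub, map_smul, hω.1,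
    ← ql_eq] at h2
  rw [h1]
  simpa using h2

/-! ### Limits of ground vectors of finite boxes -/

/-- Convergence of expectations of local observables. -/
def LocTendsto (f : ℕ → QL d n →ₗ[ℂ] ℂ) (ω : QL d n →ₗ[ℂ] ℂ) : Prop :=
  ∀ a : QL d n, (a : Hil d n →L[ℂ] Hil d n) ∈ locAlg d n →
    Tendsto (fun k => f k a) atTop (𝓝 (ω a))

theorem eventually_subset_box {ℓ : ℕ → ℕ} (hℓ : Tendsto ℓ atTop atTop) (Γ : Finset (Site d)) :
    ∀ᶠ k in atTop, Γ ⊆ box d (ℓ k) := by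
  obtain ⟨L, hL⟩ := exists_subset_box Γ
  filter_upwards [hℓ.eventually_ge_atTop L] with k hk
  exact hL.trans (box_mono hk)

/-- Every Γ eventually lies in the boxes, so the default value 0 in `finExpect` is invisible in the
limit. -/
theorem locTendsto_iff {ℓ : ℕ → ℕ} (hℓ : Tendsto ℓ atTop atTop)
    (Φ : ∀ k, LocConf n (box d (ℓ k)) → ℂ) :
    LocTendsto (fun k => vecState (Φ k)) ω ↔ ∀ (Γ : Finset (Site d)) (A : LocMat n Γ),
      Tendsto (fun k => finExpect (Φ k) A) atTop (𝓝 (ω (ql Γ A))) := by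
  have key : ∀ (Γ : Finset (Site d)) (A : LocMat n Γ),
      (fun k => finExpect (Φ k) A) =ᶠ[atTop] fun k => vecState (Φ k) (ql Γ A) := fun Γ A => by
    filter_upwards [eventually_subset_box hℓ Γ] with k hk
    exact finExpect_eq (Φ k) hk A
  constructor
  · intro h Γ A
    rw [tendsto_congr' (key Γ A)]
    exact h _ (ql_mem_locAlg Γ A)
  · rintro h a ⟨Γ, A, hA⟩
    have : a = ql Γ A := ext_ql hA.symm
    rw [this, ← tendsto_congr' (key Γ A)]
    exact h Γ A

/-- When both Γ and its translate fit into the box, the periodic translation does not wrap on Γ and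
agrees with that of the lattice. -/
theorem emb_shiftMat {L : ℕ} (hL : 1 ≤ L) (v : Site d) {Γ : Finset (Site d)} (h : Γ ⊆ box d L)
    (h' : Γ.map (addRightEmbedding (2 • v)) ⊆ box d L) (A : LocMat n Γ) :
    emb h' (shiftMat (2 • v) A) = matPerm n hL v (emb h A) := by
  have hP : ∀ y : box d L, (y : Site d) ∈ Γ →
      ∃ hy : (y : Site d) + 2 • v ∈ box d L, boxPerm hL v y = ⟨(y : Site d) + 2 • v, hy⟩ := by
    intro y hy
    have h1 := h' (Finset.mem_map_of_mem (addRightEmbedding (2 • v)) hy)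
    exact ⟨h1, Subtype.ext (eq_boxShift hL h1 fun i => modEq_of_eq (by simp)).symm⟩
  have hmem : ∀ y : box d L,
      (boxPerm hL v y : Site d) ∈ Γ.map (addRightEmbedding (2 • v)) ↔ (y : Site d) ∈ Γ := by
    intro y
    constructor
    · intro hy
      obtain ⟨z, hz, e⟩ := Finset.mem_map.1 hy
      obtain ⟨h1, h2⟩ := hP ⟨z, h hz⟩ hz
      have : boxPerm hL v y = boxPerm hL v ⟨z, h hz⟩ := by
        rw [h2]; exact Subtype.ext e.symm
      rw [(boxPerm hL v).injective this]
      exact hz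
    · intro hy
      obtain ⟨h1, h2⟩ := hP y hy
      rw [h2]
      exact Finset.mem_map_of_mem (addRightEmbedding (2 • v)) hy
  ext σ τ
  simp only [matPerm_apply, Matrix.submatrix_apply, emb, Matrix.of_apply, confPerm_apply, shiftMat]
  refine if_congr ⟨fun H y hy => H _ fun e => hy ((hmem y).1 e), fun H y hy => ?_⟩ ?_ rfl
  · have := H ((boxPerm hL v).symm y)
    rw [Equiv.apply_symm_apply] at this
    refine this fun e => hy ?_
    rw [← hmem, Equiv.apply_symm_apply] at e
    exact e
  · congr 1
    all_goals
      funext x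
      obtain ⟨h1, h2⟩ := hP ⟨x, h x.2⟩ x.2
      rw [h2]

theorem LocTendsto.isPeriodTwo {ℓ : ℕ → ℕ} (hℓ : Tendsto ℓ atTop atTop)
    {Φ : ∀ k, LocConf n (box d (ℓ k)) → ℂ} (hΦ : ∀ᶠ k in atTop, IsPeriodTwoVector (Φ k))
    (h : LocTendsto (fun k => vecState (Φ k)) ω) : IsPeriodTwo ω := by
  intro v Γ A
  refine tendsto_nhds_unique (h _ (ql_mem_locAlg _ (shiftMat (2 • v) A)))
    ((h _ (ql_mem_locAlg _ A)).congr' ?_)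
  filter_upwards [eventually_subset_box hℓ Γ, eventually_subset_box hℓ _,
    hℓ.eventually_ge_atTop 1, hΦ] with k h1 h2 h3 h4
  rw [← ql_emb h1, ← ql_emb h2, emb_shiftMat h3 v h1 h2, vecState_ql, vecState_ql,
    expect_matPerm h3 h4]

theorem LocTendsto.tendsto_magVec {ℓ : ℕ → ℕ} (hℓ : Tendsto ℓ atTop atTop)
    {Φ : ∀ k, LocConf n (box d (ℓ k)) → ℂ} (hΦ : ∀ᶠ k in atTop, IsPeriodTwoVector (Φ k))
    (h : LocTendsto (fun k => vecState (Φ k)) ω) :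
    Tendsto (fun k => magVec (Φ k)) atTop (𝓝 (magIn ω 1)) := by
  have h1 := ((Complex.continuous_re.tendsto _).comp
    (h _ (ql_mem_locAlg _ (stag d n 1)))).div_const ((box d 1).card : ℝ)
  refine h1.congr' ?_
  filter_upwards [hℓ.eventually_ge_atTop 1, hΦ] with k h3 h4
  rw [h4.magVec_eq h3]
  rfl

theorem cell_mem_locAlg (B : ℝ) : (cell d n B : Hil d n →L[ℂ] Hil d n) ∈ locAlg d n := by
  simp only [cell, cellZero, AddSubgroupClass.coe_sub, AddSubmonoidClass.coe_finsetSum,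
    SetLike.val_smul]
  refine sub_mem (SMulMemClass.smul_mem _ (sum_mem fun x _ => sum_mem fun y _ => ?_))
    (SMulMemClass.smul_mem _ (ql_mem_locAlg _ _))
  exact bond_mem_locAlg x y

/-- Limits of ground vectors of period two minimize the energy per cell among the states of
period two. -/
theorem LocTendsto.cell_le {ℓ : ℕ → ℕ} (hℓ : Tendsto ℓ atTop atTop) {B : ℝ}
    {Φ : ∀ k, LocConf n (box d (ℓ k)) → ℂ}
    (hΦ : ∀ᶠ k in atTop, IsGroundVector (ham d n (ℓ k) B) (Φ k) ∧ IsPeriodTwoVector (Φ k))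
    (h : LocTendsto (fun k => vecState (Φ k)) ω) {ω' : QL d n →ₗ[ℂ] ℂ} (h' : IsState ω')
    (hp : IsPeriodTwo ω') : (ω (cell d n B)).re ≤ (ω' (cell d n B)).re := by
  have h1 := (Complex.continuous_re.tendsto _).comp (h _ (cell_mem_locAlg B))
  -- The boundary term is divided by the number L^d of cells; the factor 2^d converts this into the
  -- volume (2L)^d.
  have h2 : Tendsto (fun k => (ω' (cell d n B)).re + (2 ^ d * (3 ^ d * (3 * spinBound n ^ 2))) *
      (((bdry d (ℓ k)).card : ℝ) / (2 * ℓ k : ℝ) ^ d)) atTop (𝓝 (ω' (cell d n B)).re) := by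
    simpa using (((tendsto_card_bdry_div d).comp hℓ).const_mul
      (2 ^ d * (3 ^ d * (3 * spinBound n ^ 2)))).const_add (ω' (cell d n B)).re
  refine le_of_tendsto_of_tendsto h1 h2 ?_
  filter_upwards [hΦ, hℓ.eventually_ge_atTop 2] with k hk hk2
  have h3 := hk.1.expect_le h'
  have h4 := hp.apply_ham_le h' (ℓ k) B
  rw [hk.2.apply_ham hk2] at h3
  have hpos : (0 : ℝ) < (ℓ k : ℝ) := by exact_mod_cast (by omega : 0 < ℓ k)
  have h5 : (ℓ k : ℝ) ^ d * (vecState (Φ k) (cell d n B)).re ≤ (ℓ k : ℝ) ^ d *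
      ((ω' (cell d n B)).re + (2 ^ d * (3 ^ d * (3 * spinBound n ^ 2))) *
      (((bdry d (ℓ k)).card : ℝ) / (2 * ℓ k : ℝ) ^ d)) := by
    refine (h3.trans h4).trans (le_of_eq ?_)
    rw [mul_pow]
    field_simp
  exact le_of_mul_le_mul_left h5 (by positivity)

theorem cell_re (ω : QL d n →ₗ[ℂ] ℂ) (B : ℝ) :
    (ω (cell d n B)).re = (ω (cellZero d n)).re - B * (2 ^ d * magIn ω 1) := by
  rw [cell, map_sub, map_smul, smul_eq_mul, Complex.sub_re, Complex.re_ofReal_mul, magIn, card_box]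
  push_cast
  field_simp

/-- The magnetization of limits of ground vectors is nondecreasing in the field. -/
theorem LocTendsto.magIn_le {ℓ ℓ' : ℕ → ℕ} (hℓ : Tendsto ℓ atTop atTop)
    (hℓ' : Tendsto ℓ' atTop atTop) {B B' : ℝ} (hB : B < B')
    {Φ : ∀ k, LocConf n (box d (ℓ k)) → ℂ} {Φ' : ∀ k, LocConf n (box d (ℓ' k)) → ℂ}
    (hΦ : ∀ᶠ k in atTop, IsGroundVector (ham d n (ℓ k) B) (Φ k) ∧ IsPeriodTwoVector (Φ k))
    (hΦ' : ∀ᶠ k in atTop, IsGroundVector (ham d n (ℓ' k) B') (Φ' k) ∧ IsPeriodTwoVector (Φ' k))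
    {ω' : QL d n →ₗ[ℂ] ℂ} (hω : IsState ω) (hω' : IsState ω')
    (h : LocTendsto (fun k => vecState (Φ k)) ω) (h' : LocTendsto (fun k => vecState (Φ' k)) ω') :
    magIn ω 1 ≤ magIn ω' 1 := by
  -- Each state competes in the variational principle of the other; adding the two inequalities
  -- cancels the exchange energies and leaves (B' - B) times the difference of the magnetizations.
  have h1 := h.cell_le hℓ hΦ hω' (h'.isPeriodTwo hℓ' (hΦ'.mono fun _ h => h.2))
  have h2 := h'.cell_le hℓ' hΦ' hω (h.isPeriodTwo hℓ (hΦ.mono fun _ h => h.2))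
  rw [cell_re, cell_re] at h1 h2
  have h3 : (B' - B) * 2 ^ d * magIn ω 1 ≤ (B' - B) * 2 ^ d * magIn ω' 1 := by linarith
  exact le_of_mul_le_mul_left h3 (mul_pos (sub_pos.2 hB) (by positivity))

end PeriodTwo

/-! ### Weak-* compactness -/

section Compactness

variable {d n : ℕ}

/-- There are countably many Γ, each with a finite-dimensional algebra. Separability makes the dual
unit ball sequentially weak-* compact, so that subsequences suffice. -/
theorem isSeparable_QL (d n : ℕ) :
    TopologicalSpace.IsSeparable (QL d n : Set (Hil d n →L[ℂ] Hil d n)) := by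
  have h1 : ((locAlg d n : StarSubalgebra ℂ _) : Set (Hil d n →L[ℂ] Hil d n)) =
      ⋃ Γ : Finset (Site d), Set.range (locRep (n := n) Γ) := by
    ext a
    simp only [Set.mem_iUnion, Set.mem_range]
    rfl
  rw [StarSubalgebra.topologicalClosure_coe, h1]
  refine (TopologicalSpace.IsSeparable.iUnion fun Γ => ?_).closure
  have : Continuous (locRep (n := n) Γ) :=
    (locRep (n := n) Γ).toAlgHom.toLinearMap.continuous_of_finiteDimensional
  have : TopologicalSpace.SeparableSpace (LocMat n Γ) :=
    inferInstanceAs (TopologicalSpace.SeparableSpace (LocConf n Γ → LocConf n Γ → ℂ))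
  exact TopologicalSpace.isSeparable_range ‹Continuous _›

/-- Sequences of vector states have weak-* convergent subsequences. -/
theorem exists_locTendsto_subseq {ℓ : ℕ → ℕ} (Φ : ∀ k, LocConf n (box d (ℓ k)) → ℂ)
    (hΦ : ∀ᶠ k in atTop, star (Φ k) ⬝ᵥ Φ k = 1) :
    ∃ (φ : ℕ → ℕ) (ω : QL d n →ₗ[ℂ] ℂ), StrictMono φ ∧ IsState ω ∧
      LocTendsto (fun k => vecState (Φ (φ k))) ω := by
  -- Dropping the first K terms makes every vector normalized; the shift is absorbed into the
  -- subsequence at the end.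
  obtain ⟨K, hK⟩ := eventually_atTop.1 hΦ
  have : TopologicalSpace.SeparableSpace (QL d n) := (isSeparable_QL d n).separableSpace
  have hbound : ∀ k a, ‖vecState (Φ (k + K)) a‖ ≤ 1 * ‖a‖ := fun k a => by
    rw [one_mul]; exact norm_vecState_le (hK _ (Nat.le_add_left K k)) a
  let f : ℕ → WeakDual ℂ (QL d n) := fun k => StrongDual.toWeakDual
    ((vecState (Φ (k + K))).mkContinuous 1 (hbound k))
  have hf : ∀ k, f k ∈ WeakDual.toStrongDual ⁻¹' Metric.closedBall (0 : StrongDual ℂ (QL d n)) 1 := by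
    intro k
    have h1 : ‖(vecState (Φ (k + K))).mkContinuous 1 (hbound k)‖ ≤ 1 :=
      LinearMap.mkContinuous_norm_le _ zero_le_one _
    rw [← dist_zero_right] at h1
    exact h1
  obtain ⟨g, -, φ, hφ, hg⟩ := WeakDual.isSeqCompact_closedBall ℂ (QL d n) 0 1 hf
  have hlim : ∀ a : QL d n, Tendsto (fun k => vecState (Φ (φ k + K)) a) atTop (𝓝 (g a)) :=
    fun a => ((WeakDual.eval_continuous a).tendsto g).comp hg
  refine ⟨fun k => φ k + K, (WeakDual.toStrongDual g).toLinearMap,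
    fun i j h => Nat.add_lt_add_right (hφ h) K, ⟨?_, fun a => ?_⟩, fun a _ => hlim a⟩
  · refine tendsto_nhds_unique (hlim 1) (tendsto_const_nhds.congr fun k => ?_)
    exact (isState_vecState (hK _ (Nat.le_add_left K (φ k)))).1.symm
  · have hs := fun k => isState_vecState (hK _ (Nat.le_add_left K (φ k)))
    have h1 := (Complex.continuous_re.tendsto _).comp (hlim (star a * a))
    have h2 := (Complex.continuous_im.tendsto _).comp (hlim (star a * a))
    refine ⟨(g (star a * a)).re, ge_of_tendsto' h1 fun k => (hs k).re_nonneg a, ?_⟩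
    refine Complex.ext rfl ?_
    rw [Complex.ofReal_im]
    exact tendsto_nhds_unique h2 (tendsto_const_nhds.congr fun k => ((hs k).im_eq_zero a).symm)

end Compactness

/-! ### Ground states of the infinite system -/

section GroundState

variable {d n : ℕ}

theorem bond_commute {x y : Site d} {Γ : Finset (Site d)} (hx : x ∉ Γ) (hy : y ∉ Γ)
    (A : LocMat n Γ) : Commute (bond n x y) (ql Γ A) :=
  Commute.sum_left _ _ _ fun _ _ => (spinQ_commute hx A).mul_left (spinQ_commute hy A)

/-- The commutator of a local observable with the Hamiltonian of a large box does not depend on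
the box. -/
theorem hamZero_commutator_eq {Γ : Finset (Site d)} (A : LocMat n Γ) {L L' : ℕ}
    (hL : ∀ x ∈ Γ, Interior L x) (hL' : ∀ x ∈ Γ, Interior L' x) :
    ql _ (hamZero d n L) * ql Γ A - ql Γ A * ql _ (hamZero d n L) =
      ql _ (hamZero d n L') * ql Γ A - ql Γ A * ql _ (hamZero d n L') := by
  have key : ∀ M : ℕ, ql _ (hamZero d n M) * ql Γ A - ql Γ A * ql _ (hamZero d n M) =
      (1 / 2 : ℂ) • ∑ x ∈ box d M, ∑ y ∈ (box d M).filter (PerAdj M x),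
        (bond n x y * ql Γ A - ql Γ A * bond n x y) := by
    intro M
    simp only [ql_hamZero, smul_mul_assoc, mul_smul_comm, Finset.sum_mul, Finset.mul_sum,
      ← smul_sub, Finset.sum_sub_distrib]
  have h0 : ∀ x y, x ∉ Γ → y ∉ Γ → bond n x y * ql Γ A - ql Γ A * bond n x y = 0 :=
    fun x y hx hy => sub_eq_zero.2 (bond_commute hx hy A).eq
  rw [key, key, sum_perAdj_of_support h0 hL, sum_perAdj_of_support h0 hL']

theorem stag_commutator_eq {Γ : Finset (Site d)} (A : LocMat n Γ) {L : ℕ} (hL : Γ ⊆ box d L) :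
    ql _ (stag d n L) * ql Γ A - ql Γ A * ql _ (stag d n L) =
      ∑ x ∈ Γ, sgn x • (spinQ n 2 x * ql Γ A - ql Γ A * spinQ n 2 x) := by
  simp only [ql_stag, Finset.sum_mul, Finset.mul_sum, smul_mul_assoc, mul_smul_comm,
    ← Finset.sum_sub_distrib, ← smul_sub]
  symm
  refine Finset.sum_subset hL fun x _ hx => ?_
  rw [(spinQ_commute hx A).eq, sub_self, smul_zero]

/-- Limits of ground vectors in vanishing fields are ground states. -/
theorem LocTendsto.isGroundState {ω : QL d n →ₗ[ℂ] ℂ} {ℓ : ℕ → ℕ} (hℓ : Tendsto ℓ atTop atTop)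
    {B : ℕ → ℝ} (hB : Tendsto B atTop (𝓝 0)) {Φ : ∀ k, LocConf n (box d (ℓ k)) → ℂ}
    (hΦ : ∀ᶠ k in atTop, IsGroundVector (ham d n (ℓ k) (B k)) (Φ k))
    (h : LocTendsto (fun k => vecState (Φ k)) ω) (hω : IsState ω) : IsGroundState ω := by
  refine ⟨hω, ?_⟩
  rintro a ⟨Γ, A, hA⟩
  have ha : a = ql Γ A := ext_ql hA.symm
  obtain ⟨L₀, hL₀⟩ := exists_subset_box Γ
  have hint : ∀ L, L₀ + 1 ≤ L → ∀ x ∈ Γ, Interior L x := fun L hL x hx =>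
    interior_of_mem_box (by omega) (hL₀ hx)
  set K : QL d n := ql _ (hamZero d n (L₀ + 1)) * a - a * ql _ (hamZero d n (L₀ + 1)) with hK
  set J : QL d n := ∑ x ∈ Γ, sgn x • (spinQ n 2 x * a - a * spinQ n 2 x) with hJ
  have hKL : ∀ L, L₀ + 1 ≤ L →
      ql _ (hamZero d n L) * a - a * ql _ (hamZero d n L) = K := fun L hL => by
    rw [hK, ha]
    exact hamZero_commutator_eq A (hint L hL) (hint _ le_rfl)
  have ha' : (a : Hil d n →L[ℂ] Hil d n) ∈ locAlg d n := ⟨Γ, A, hA⟩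
  have hKmem : ((star a * K : QL d n) : Hil d n →L[ℂ] Hil d n) ∈ locAlg d n := by
    refine mul_mem (star_mem ha') (sub_mem (mul_mem (ql_mem_locAlg _ _) ha')
      (mul_mem ha' (ql_mem_locAlg _ _)))
  have hJmem : ((star a * J : QL d n) : Hil d n →L[ℂ] Hil d n) ∈ locAlg d n := by
    refine mul_mem (star_mem ha') ?_
    rw [hJ, AddSubmonoidClass.coe_finsetSum]
    exact sum_mem fun x _ => SMulMemClass.smul_mem _ (sub_mem
      (mul_mem (spinQ_mem_locAlg _ _) ha') (mul_mem ha' (spinQ_mem_locAlg _ _)))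
  -- K and J are fixed local observables, so the field enters only through the scalar B k and
  -- disappears.
  have hlim : Tendsto (fun k => vecState (Φ k) (star a * (K - (B k : ℂ) • J))) atTop
      (𝓝 (ω (star a * K))) := by
    have h1 := (h _ hKmem).sub (((Complex.continuous_ofReal.tendsto 0).comp hB).mul (h _ hJmem))
    simp only [Complex.ofReal_zero, zero_mul, sub_zero] at h1
    refine h1.congr fun k => ?_
    simp [mul_sub]
  have hpos : ∀ᶠ k in atTop, ∃ r : ℝ, 0 ≤ r ∧
      vecState (Φ k) (star a * (K - (B k : ℂ) • J)) = r := by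
    filter_upwards [hΦ, hℓ.eventually_ge_atTop (L₀ + 1)] with k hk hk'
    have hsub : Γ ⊆ box d (ℓ k) := hL₀.trans (box_mono (by omega))
    obtain ⟨r, hr, e⟩ := hk.expect_commutator (isHermitian_ham _ _) (emb hsub A)
    refine ⟨r, hr, ?_⟩
    rw [← e, ← vecState_ql]
    congr 1
    rw [ql_eq, map_mul, map_star, map_sub, map_mul, map_mul, ← ql_eq, ← ql_eq, ql_emb, ← ha,
      ql_ham, ← hKL _ hk', hJ]
    congr 1
    have h2 := stag_commutator_eq A hsub
    rw [← ha] at h2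
    rw [← h2]
    simp only [sub_mul, mul_sub, smul_sub, smul_mul_assoc, mul_smul_comm]
    abel
  have h1 := (Complex.continuous_re.tendsto _).comp hlim
  have h2 := (Complex.continuous_im.tendsto _).comp hlim
  refine ⟨(ω (star a * K)).re, ge_of_tendsto h1 ?_, ?_⟩
  · filter_upwards [hpos] with k hk
    obtain ⟨r, hr, e⟩ := hk
    rwa [Function.comp_apply, e, Complex.ofReal_re]
  · have him : (ω (star a * K)).im = 0 := by
      refine tendsto_nhds_unique h2 (tendsto_const_nhds.congr' ?_)
      filter_upwards [hpos] with k hk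
      obtain ⟨r, hr, e⟩ := hk
      rw [Function.comp_apply, e, Complex.ofReal_im]
    have e : (((ω (star a * K)).re : ℝ) : ℂ) = ω (star a * K) := Complex.ext rfl (by simp [him])
    rw [e]
    refine tendsto_const_nhds.congr' ?_
    filter_upwards [eventually_ge_atTop (L₀ + 1)] with L hL
    rw [hKL L hL]

/-! ### Ground states minimize the energy in boxes up to boundary terms -/

variable {Γ : Finset (Site d)}

/-- The observable `|Φ⟩⟨τ|`. -/
def replaceMat (Φ : LocConf n Γ → ℂ) (τ : LocConf n Γ) : LocMat n Γ :=
  Matrix.vecMulVec Φ (Pi.single τ 1)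

theorem star_replaceMat_mul_mul (Φ : LocConf n Γ → ℂ) (τ : LocConf n Γ) (A : LocMat n Γ) :
    star (replaceMat Φ τ) * (A * replaceMat Φ τ) =
      expect Φ A • Matrix.diagonal (Pi.single τ 1) := by
  rw [replaceMat, Matrix.star_eq_conjTranspose, Matrix.conjTranspose_vecMulVec,
    Matrix.mul_vecMulVec, Matrix.vecMulVec_mul_vecMulVec, ← expect]
  ext σ ρ
  simp only [Matrix.vecMulVec_apply, Matrix.smul_apply, Matrix.diagonal_apply, Pi.star_apply,
    Pi.smul_apply, Pi.single_apply, smul_eq_mul]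
  by_cases h1 : σ = τ <;> by_cases h2 : ρ = τ <;> by_cases h3 : σ = ρ <;>
    simp_all

theorem sum_diagonal_single :
    ∑ τ : LocConf n Γ, (Matrix.diagonal (Pi.single τ 1) : LocMat n Γ) = 1 := by
  ext σ ρ
  simp [Matrix.sum_apply, Matrix.diagonal_apply, Matrix.one_apply, Pi.single_apply]

/-- The map `X ↦ ∑_τ a_τ* [X, a_τ]` with `a_τ = |Φ⟩⟨τ|`. -/
def replaceMap (Φ : LocConf n Γ → ℂ) : QL d n →ₗ[ℂ] QL d n :=
  ∑ τ : LocConf n Γ, LinearMap.mulLeft ℂ (star (ql Γ (replaceMat Φ τ))) ∘ₗ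
    (LinearMap.mulRight ℂ (ql Γ (replaceMat Φ τ)) - LinearMap.mulLeft ℂ (ql Γ (replaceMat Φ τ)))

theorem replaceMap_apply (Φ : LocConf n Γ → ℂ) (X : QL d n) :
    replaceMap Φ X = ∑ τ : LocConf n Γ, star (ql Γ (replaceMat Φ τ)) *
      (X * ql Γ (replaceMat Φ τ) - ql Γ (replaceMat Φ τ) * X) := by
  simp [replaceMap]

/-- The a_τ* A a_τ sum to ⟨Φ, AΦ⟩ times the unit, and the a_τ* a_τ sum to the unit: inside Γ the
state is replaced by Φ. -/
theorem replaceMap_ql {Φ : LocConf n Γ → ℂ} (hΦ : star Φ ⬝ᵥ Φ = 1) (A : LocMat n Γ) :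
    replaceMap Φ (ql Γ A) = vecState Φ (ql Γ A) • 1 - ql Γ A := by
  have h1 : ∑ τ, star (replaceMat Φ τ) * (A * replaceMat Φ τ - replaceMat Φ τ * A) =
      expect Φ A • 1 - A := by
    simp only [mul_sub, ← mul_assoc (star _) _ A, Finset.sum_sub_distrib, star_replaceMat_mul_mul,
      ← Finset.smul_sum, sum_diagonal_single, ← Finset.sum_mul]
    congr 1
    have h2 : ∀ τ, star (replaceMat Φ τ) * replaceMat Φ τ = Matrix.diagonal (Pi.single τ 1) :=
      fun τ => by
        have := star_replaceMat_mul_mul Φ τ 1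
        rwa [one_mul, expect_one, hΦ, one_smul] at this
    simp only [h2, sum_diagonal_single, one_mul]
  have h3 := congrArg (qlHom Γ) h1
  simp only [map_sum, map_mul, map_star, map_sub, map_smul, map_one] at h3
  rw [replaceMap_apply, vecState_ql]
  exact h3

/-- The map is linear over the commutant of the algebra of Γ. This handles bonds with one end
outside Γ, to which `replaceMap_ql` does not apply. -/
theorem replaceMap_mul_of_commute (Φ : LocConf n Γ → ℂ) (Z : QL d n) {Y : QL d n}
    (hY : ∀ A : LocMat n Γ, Commute Y (ql Γ A)) : replaceMap Φ (Z * Y) = replaceMap Φ Z * Y := by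
  simp only [replaceMap_apply, Finset.sum_mul]
  refine Finset.sum_congr rfl fun τ _ => ?_
  rw [mul_assoc Z, (hY _).eq]
  simp only [mul_sub, sub_mul, mul_assoc]

theorem replaceMap_mul_of_commute' (Φ : LocConf n Γ → ℂ) (Z : QL d n) {Y : QL d n}
    (hY : ∀ A : LocMat n Γ, Commute Y (ql Γ A)) : replaceMap Φ (Y * Z) = Y * replaceMap Φ Z := by
  simp only [replaceMap_apply, Finset.mul_sum]
  refine Finset.sum_congr rfl fun τ _ => ?_
  have h1 : Y * star (ql Γ (replaceMat Φ τ)) = star (ql Γ (replaceMat Φ τ)) * Y := by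
    rw [ql_eq, ← map_star]; exact (hY _).eq
  rw [← mul_assoc Y, h1, mul_assoc (star _), mul_sub, ← mul_assoc (ql _ _) Y, ← (hY _).eq]
  simp only [mul_assoc, mul_sub]

theorem replaceMap_of_commute (Φ : LocConf n Γ → ℂ) {Y : QL d n}
    (hY : ∀ A : LocMat n Γ, Commute Y (ql Γ A)) : replaceMap Φ Y = 0 := by
  rw [replaceMap_apply]
  refine Finset.sum_eq_zero fun τ _ => ?_
  rw [(hY _).eq, sub_self, mul_zero]

/-- The closed form gives a constant independent of Γ; bounding the sum over τ term by term would
give one exponential in the volume. -/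
theorem norm_replaceMap_ql_le {Φ : LocConf n Γ → ℂ} (hΦ : star Φ ⬝ᵥ Φ = 1) (A : LocMat n Γ) :
    ‖replaceMap Φ (ql Γ A)‖ ≤ 2 * ‖ql Γ A‖ := by
  rw [replaceMap_ql hΦ]
  refine (norm_sub_le _ _).trans ?_
  have h1 : ‖(1 : QL d n)‖ ≤ 1 := ContinuousLinearMap.norm_id_le
  have h2 := norm_vecState_le hΦ (ql Γ A)
  have h3 := norm_smul_le (vecState Φ (ql Γ A)) (1 : QL d n)
  nlinarith [norm_nonneg (vecState Φ (ql Γ A)), norm_nonneg (1 : QL d n), norm_nonneg (ql Γ A)]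

theorem norm_replaceMap_bond_le {Φ : LocConf n Γ → ℂ} (hΦ : star Φ ⬝ᵥ Φ = 1) (x y : Site d) :
    ‖replaceMap Φ (bond n x y)‖ ≤ 6 * spinBound n ^ 2 := by
  have hspin : ∀ (j : Fin 3) (z : Γ), ‖replaceMap Φ (spinQ n j (z : Site d))‖ ≤ 2 * spinBound n :=
    fun j z => by
      rw [← ql_spinAt]
      refine (norm_replaceMap_ql_le hΦ _).trans ?_
      rw [ql_spinAt]
      linarith [norm_spinQ_le (n := n) j (z : Site d)]
  have h0 := spinBound_nonneg n
  by_cases hx : x ∈ Γ <;> by_cases hy : y ∈ Γ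
  · rw [← ql_bond (⟨x, hx⟩ : Γ) ⟨y, hy⟩]
    refine (norm_replaceMap_ql_le hΦ _).trans ?_
    rw [ql_bond]
    linarith [norm_bond_le (n := n) x y]
  · rw [bond, map_sum]
    have : ∀ j ∈ (Finset.univ : Finset (Fin 3)),
        ‖replaceMap Φ (spinQ n j x * spinQ n j y)‖ ≤ 2 * spinBound n * spinBound n := fun j _ => by
      rw [replaceMap_mul_of_commute Φ _ (spinQ_commute hy)]
      exact (norm_mul_le _ _).trans (mul_le_mul (hspin j ⟨x, hx⟩) (norm_spinQ_le _ _)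
        (norm_nonneg _) (by positivity))
    refine (norm_sum_le_of_le _ this).trans (le_of_eq ?_)
    simp; ring
  · rw [bond, map_sum]
    have : ∀ j ∈ (Finset.univ : Finset (Fin 3)),
        ‖replaceMap Φ (spinQ n j x * spinQ n j y)‖ ≤ spinBound n * (2 * spinBound n) := fun j _ => by
      rw [replaceMap_mul_of_commute' Φ _ (spinQ_commute hx)]
      exact (norm_mul_le _ _).trans (mul_le_mul (norm_spinQ_le _ _) (hspin j ⟨y, hy⟩)
        (norm_nonneg _) (by positivity))
    refine (norm_sum_le_of_le _ this).trans (le_of_eq ?_)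
    simp; ring
  · rw [replaceMap_of_commute Φ (bond_commute hx hy), norm_zero]
    positivity

/-- Summing the ground-state inequality over the a_τ gives 0 ≤ ω(`replaceMap Φ` H) for large boxes.
Up to crossing and wrapping bonds this is ⟨Φ, HΦ⟩ - ω(H) for the small box. The constant 9 is half
of 3 * 6, the half coming from the count of ordered pairs. -/
theorem IsGroundState.hamZero_le {ω : QL d n →ₗ[ℂ] ℂ} (h : IsGroundState ω) {L : ℕ}
    {Φ : LocConf n (box d L) → ℂ} (hΦ : star Φ ⬝ᵥ Φ = 1) :
    (ω (ql _ (hamZero d n L))).re ≤ (expect Φ (hamZero d n L)).re +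
      (3 ^ d * (9 * spinBound n ^ 2)) * (bdry d L).card := by
  have hham : ∀ M : ℕ, (ω (replaceMap Φ (ql _ (hamZero d n M)))).re = 1 / 2 *
      ∑ x ∈ box d M, ∑ y ∈ (box d M).filter (PerAdj M x),
        (ω (replaceMap Φ (bond n x y))).re := by
    intro M
    simp [ql_hamZero]
  have hbound : ∀ M : ℕ, L + 1 ≤ M → (ω (replaceMap Φ (ql _ (hamZero d n M)))).re ≤
      (expect Φ (hamZero d n L)).re - (ω (ql _ (hamZero d n L))).re +
      (3 ^ d * (9 * spinBound n ^ 2)) * (bdry d L).card := by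
    intro M hM
    have h1 := abs_sum_perAdj_sub_le (F := fun x y => (ω (replaceMap Φ (bond n x y))).re)
      (c := 6 * spinBound n ^ 2) (by positivity)
      (fun x y => (h.1.abs_re_le_norm _).trans (norm_replaceMap_bond_le hΦ x y))
      (show L < M by omega) (fun x y hx hy => by
        rw [replaceMap_of_commute Φ (bond_commute hx hy), map_zero, Complex.zero_re])
    have h2 := hham L
    rw [replaceMap_ql hΦ, map_sub, map_smul, h.1.1, vecState_ql, smul_eq_mul, mul_one,
      Complex.sub_re] at h2
    rw [hham M, h2]
    rw [abs_le] at h1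
    linarith [h1.2]
  have hlim : ∃ r : ℝ, 0 ≤ r ∧ Tendsto (fun M => ω (replaceMap Φ (ql _ (hamZero d n M)))) atTop
      (𝓝 (r : ℂ)) := by
    choose r hr ht using fun τ => h.2 _ (ql_mem_locAlg (box d L) (replaceMat Φ τ))
    refine ⟨∑ τ, r τ, Finset.sum_nonneg fun τ _ => hr τ, ?_⟩
    simp only [replaceMap_apply, map_sum, Complex.ofReal_sum]
    exact tendsto_finsetSum _ fun τ _ => ht τ
  obtain ⟨r, hr, ht⟩ := hlim
  have h1 := (Complex.continuous_re.tendsto _).comp ht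
  have h2 : r ≤ _ := le_of_tendsto h1 (eventually_atTop.2 ⟨L + 1, hbound⟩)
  linarith

theorem ham_zero (L : ℕ) : ham d n L 0 = hamZero d n L := by simp [ham]

/-- The magnetization of a ground state is bounded by that of ground vectors in a field, up to
boundary terms. -/
theorem IsGroundState.magIn_le {ω : QL d n →ₗ[ℂ] ℂ} (h : IsGroundState ω) {L : ℕ} (hL : 1 ≤ L)
    {B : ℝ} (hB : 0 < B) {Φ : LocConf n (box d L) → ℂ} (hΦ : IsGroundVector (ham d n L B) Φ) :
    magIn ω L ≤ magVec Φ +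
      (3 ^ d * (9 * spinBound n ^ 2)) / B * (((bdry d L).card : ℝ) / (2 * L : ℝ) ^ d) := by
  obtain ⟨Ψ, hΨ, -⟩ := exists_groundVector_ham (d := d) (n := n) hL 0
  -- Three comparisons: Φ minimizes in the field B, ω nearly minimizes in zero field, and Ψ has no
  -- more exchange energy than Φ. The exchange energies cancel, leaving B times the magnetizations
  -- and the surface term.
  have h1 := hΦ.expect_le h.1
  have h2 := h.hamZero_le hΨ.1
  have h3 := hΨ.expect_le (isState_vecState hΦ.1)
  rw [vecState_ql, ham_zero] at h3
  have e1 : (expect Φ (ham d n L B)).re =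
      (expect Φ (hamZero d n L)).re - B * (expect Φ (stag d n L)).re := by
    rw [ham, expect_sub, expect_smul, Complex.sub_re, Complex.re_ofReal_mul]
  have e2 : (ω (ql _ (ham d n L B))).re =
      (ω (ql _ (hamZero d n L))).re - B * (ω (ql _ (stag d n L))).re := by
    rw [ql_ham, map_sub, map_smul, smul_eq_mul, Complex.sub_re, Complex.re_ofReal_mul]
  have hpos : (0 : ℝ) < (2 * L : ℝ) ^ d := by
    have : (0 : ℝ) < L := by exact_mod_cast hL
    positivity
  have e3 : ((box d L).card : ℝ) = (2 * L : ℝ) ^ d := by rw [card_box]; push_cast; rfl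
  rw [magIn, magVec, e3, div_mul_div_comm, ← mul_div_mul_left _ _ hB.ne',
    ← mul_div_mul_left (expect Φ (stag d n L)).re _ hB.ne', ← add_div]
  refine div_le_div_of_nonneg_right ?_ (by positivity)
  linarith

end GroundState

end Heisenberg

end

/-! ### Ground families, their weak-* limits, and the bound on the maximum magnetization -/

namespace Heisenberg

theorem IsWeakStarLimit.locTendsto {d n : ℕ} {Φ : ∀ L : ℕ, LocConf n (box d L) → ℂ}
    {ℓ : ℕ → ℕ} {ω : QL d n →ₗ[ℂ] ℂ} (hℓ : Tendsto ℓ atTop atTop) (h : IsWeakStarLimit Φ ℓ ω) :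
    LocTendsto (fun k => vecState (Φ (ℓ k))) ω :=
  (locTendsto_iff hℓ fun k => Φ (ℓ k)).2 h.2

theorem IsGroundFamily.eventually {d n : ℕ} {B : ℝ}
    {Φ : ∀ L : ℕ, LocConf n (box d L) → ℂ} (h : IsGroundFamily B Φ) {ℓ : ℕ → ℕ}
    (hℓ : Tendsto ℓ atTop atTop) :
    ∀ᶠ k in atTop, IsGroundVector (ham d n (ℓ k) B) (Φ (ℓ k)) ∧ IsPeriodTwoVector (Φ (ℓ k)) := by
  filter_upwards [hℓ.eventually_ge_atTop 1] with k hk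
  exact h _ hk

theorem exists_isGroundFamily (d n : ℕ) (B : ℝ) :
    ∃ Φ : ∀ L : ℕ, LocConf n (box d L) → ℂ, IsGroundFamily B Φ := by
  have h : ∀ L : ℕ, ∃ Φ : LocConf n (box d L) → ℂ, 1 ≤ L →
      IsGroundVector (ham d n L B) Φ ∧ IsPeriodTwoVector Φ := fun L => by
    by_cases hL : 1 ≤ L
    · exact (exists_groundVector_ham hL B).imp fun Φ h _ => h
    -- Nothing is required at L = 0, so the zero vector is a filler.
    · exact ⟨0, fun h => absurd h hL⟩
  choose Φ hΦ using h
  exact ⟨Φ, hΦ⟩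

theorem IsGroundFamily.exists_isWeakStarLimit {d n : ℕ} {B : ℝ}
    {Φ : ∀ L : ℕ, LocConf n (box d L) → ℂ} (h : IsGroundFamily B Φ) {ℓ : ℕ → ℕ}
    (hℓ : Tendsto ℓ atTop atTop) :
    ∃ (φ : ℕ → ℕ) (ω : QL d n →ₗ[ℂ] ℂ), StrictMono φ ∧ IsWeakStarLimit Φ (ℓ ∘ φ) ω := by
  obtain ⟨φ, ω, hφ, hω, hlim⟩ := exists_locTendsto_subseq (fun k => Φ (ℓ k))
    ((h.eventually hℓ).mono fun k hk => hk.1.1)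
  refine ⟨φ, ω, hφ, hω, ?_⟩
  exact (locTendsto_iff (ℓ := fun k => ℓ (φ k)) (hℓ.comp hφ.tendsto_atTop)
    fun k => Φ (ℓ (φ k))).1 hlim

theorem IsState.abs_magIn_le {d n : ℕ} {ω : QL d n →ₗ[ℂ] ℂ} (h : IsState ω) (L : ℕ) :
    |magIn ω L| ≤ spinBound n := by
  have h1 : |(ω (ql _ (stag d n L))).re| ≤ (box d L).card * spinBound n := by
    refine (h.abs_re_le_norm _).trans ?_
    rw [ql_stag, ← nsmul_eq_mul]
    refine norm_sum_le_of_le _ (fun x _ => ?_) |>.trans (Finset.sum_const _).le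
    refine (norm_smul_le _ _).trans ?_
    rw [norm_sgn, one_mul]
    exact norm_spinQ_le _ _
  rw [magIn, abs_div, Nat.abs_cast]
  exact div_le_of_le_mul₀ (Nat.cast_nonneg _) (spinBound_nonneg n) (by linarith)

/-- The maximum spontaneous magnetization of a ground state does not exceed the magnetization of
some limit of given ground vectors in a staggered field. -/
theorem IsGroundState.exists_maxMag_le {d n : ℕ} {ω : QL d n →ₗ[ℂ] ℂ}
    (h : IsGroundState ω) {B : ℝ} (hB : 0 < B) {Φ : ∀ L : ℕ, LocConf n (box d L) → ℂ}
    (hΦ : IsGroundFamily B Φ) :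
    ∃ (ℓ : ℕ → ℕ) (ω' : QL d n →ₗ[ℂ] ℂ), Tendsto ℓ atTop atTop ∧ IsWeakStarLimit Φ ℓ ω' ∧
      maxMag ω ≤ magIn ω' 1 := by
  -- Boxes along which ω nearly realizes its limsup; the ground vectors in the field are then
  -- followed along a subsequence of these same boxes.
  have hfreq : ∀ k : ℕ, ∃ L ≥ k, maxMag ω - 1 / ((k : ℝ) + 1) < magIn ω L := by
    intro k
    have h1 : maxMag ω - 1 / ((k : ℝ) + 1) < limsup (fun L => magIn ω L) atTop :=
      sub_lt_self _ Nat.one_div_pos_of_nat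
    have h2 : IsCoboundedUnder (· ≤ ·) atTop fun L => magIn ω L :=
      (isBoundedUnder_of ⟨-spinBound n, fun L => (abs_le.1 (h.1.abs_magIn_le L)).1⟩ :
        IsBoundedUnder (· ≥ ·) atTop fun L => magIn ω L).isCoboundedUnder_le
    obtain ⟨L, hL⟩ := (frequently_atTop.1 (frequently_lt_of_lt_limsup h2 h1)) k
    exact ⟨L, hL⟩
  choose ℓ hℓk hℓm using hfreq
  have hℓ : Tendsto ℓ atTop atTop := tendsto_atTop_mono hℓk tendsto_id
  obtain ⟨φ, ω', hφ, hω'⟩ := hΦ.exists_isWeakStarLimit hℓ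
  have hℓφ : Tendsto (ℓ ∘ φ) atTop atTop := hℓ.comp hφ.tendsto_atTop
  refine ⟨ℓ ∘ φ, ω', hℓφ, hω', ?_⟩
  have hev := hΦ.eventually hℓφ
  have h1 := (hω'.locTendsto hℓφ).tendsto_magVec hℓφ (hev.mono fun _ h => h.2)
  have h2 := h1.add ((((tendsto_card_bdry_div d).comp hℓφ).const_mul
    ((3 ^ d * (9 * spinBound n ^ 2)) / B)).add
    (tendsto_one_div_add_atTop_nhds_zero_nat.comp hφ.tendsto_atTop))
  rw [mul_zero, add_zero, add_zero] at h2
  refine ge_of_tendsto h2 ?_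
  filter_upwards [hev, hℓφ.eventually_ge_atTop 1] with k hk hk1
  have h3 := h.magIn_le hk1 hB hk.1
  have h4 := hℓm (φ k)
  simp only [Function.comp_apply] at h3 h4 ⊢
  linarith

end Heisenberg

open Heisenberg in
theorem mainTheorem1 (d n : ℕ) (hd : 1 ≤ d) (hn : 1 ≤ n) :
    (∀ B : ℝ, 0 < B →
      (∃ Φ : ∀ L : ℕ, Heisenberg.LocConf n (Heisenberg.box d L) → ℂ,
        Heisenberg.IsGroundFamily B Φ) ∧
      ∀ Φ : ∀ L : ℕ, Heisenberg.LocConf n (Heisenberg.box d L) → ℂ,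
        Heisenberg.IsGroundFamily B Φ →
        ∀ ℓ : ℕ → ℕ, Tendsto ℓ atTop atTop →
          ∃ (φ : ℕ → ℕ) (ω : Heisenberg.QL d n →ₗ[ℂ] ℂ),
            StrictMono φ ∧ Heisenberg.IsWeakStarLimit Φ (ℓ ∘ φ) ω) ∧
    ∃ m_s : ℝ,
      (∀ (Φ : ℝ → ∀ L : ℕ, Heisenberg.LocConf n (Heisenberg.box d L) → ℂ)
          (ℓ : ℝ → ℕ → ℕ) (ω : ℝ → (Heisenberg.QL d n →ₗ[ℂ] ℂ)),
        (∀ B : ℝ, 0 < B → Heisenberg.IsGroundFamily B (Φ B) ∧ Tendsto (ℓ B) atTop atTop ∧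
          Heisenberg.IsWeakStarLimit (Φ B) (ℓ B) (ω B)) →
        ∃ m : ℝ → ℝ,
          (∀ B : ℝ, 0 < B →
            (∀ L : ℕ, 1 ≤ L → Heisenberg.magIn (ω B) L = m B) ∧
            Tendsto (fun k => Heisenberg.magVec (Φ B (ℓ B k))) atTop (𝓝 (m B))) ∧
          Tendsto m (𝓝[>] 0) (𝓝 m_s)) ∧
      IsGreatest {m : ℝ | ∃ ω : Heisenberg.QL d n →ₗ[ℂ] ℂ,
        Heisenberg.IsGroundState ω ∧ m = Heisenberg.maxMag ω} m_s ∧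
      IsGreatest {m : ℝ | ∃ ω : Heisenberg.QL d n →ₗ[ℂ] ℂ,
        Heisenberg.IsGroundState ω ∧ Heisenberg.IsPeriodTwo ω ∧
          Tendsto (fun L => Heisenberg.magIn ω L) atTop (𝓝 m)} m_s := by
  refine ⟨fun B _ => ⟨exists_isGroundFamily d n B, fun Φ hΦ ℓ hℓ =>
    hΦ.exists_isWeakStarLimit hℓ⟩, ?_⟩
  -- a reference choice of ground vectors and limits
  choose Φ₀ hΦ₀ using exists_isGroundFamily d n
  choose ℓ₀ ω₀ hmono hω₀ using fun B => (hΦ₀ B).exists_isWeakStarLimit tendsto_id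
  have hℓ₀ : ∀ B, Tendsto (id ∘ ℓ₀ B) atTop atTop := fun B => (hmono B).tendsto_atTop
  -- Only strictly ordered fields are compared; at one and the same field the argument says nothing
  -- about two different limits.
  have hle : ∀ {B B' : ℝ}, B < B' → ∀ {Φ Φ' : ∀ L : ℕ, LocConf n (box d L) → ℂ} {ℓ ℓ' : ℕ → ℕ}
      {ω ω' : QL d n →ₗ[ℂ] ℂ}, IsGroundFamily B Φ → Tendsto ℓ atTop atTop →
      IsWeakStarLimit Φ ℓ ω → IsGroundFamily B' Φ' → Tendsto ℓ' atTop atTop →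
      IsWeakStarLimit Φ' ℓ' ω' → magIn ω 1 ≤ magIn ω' 1 :=
    by
      intro B B' hB Φ Φ' ℓ ℓ' ω ω' hΦ hℓ hω hΦ' hℓ' hω'
      exact (hω.locTendsto hℓ).magIn_le hℓ hℓ' hB (hΦ.eventually hℓ) (hΦ'.eventually hℓ') hω.1
        hω'.1 (hω'.locTendsto hℓ')
  set m₀ : ℝ → ℝ := fun B => magIn (ω₀ B) 1 with hm₀
  have hbdd : BddBelow (m₀ '' Set.Ioi 0) :=
    ⟨-spinBound n, by rintro _ ⟨B, -, rfl⟩; exact (abs_le.1 ((hω₀ B).1.abs_magIn_le 1)).1⟩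
  have hne : (m₀ '' Set.Ioi 0).Nonempty := ⟨_, 1, Set.mem_Ioi.2 one_pos, rfl⟩
  set m_s : ℝ := sInf (m₀ '' Set.Ioi 0) with hms
  -- Any choice interlaced with the reference choice has the same limit: below, m B ≥ m₀ (B / 2) ≥
  -- m_s; above, m B ≤ m₀ B' for a B' at which m₀ is close to its infimum.
  have hlim : ∀ m : ℝ → ℝ, (∀ B B' : ℝ, 0 < B → B < B' → m₀ B ≤ m B' ∧ m B ≤ m₀ B') →
      Tendsto m (𝓝[>] 0) (𝓝 m_s) := by
    intro m hm
    rw [tendsto_order]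
    constructor
    · intro a ha
      filter_upwards [self_mem_nhdsWithin] with B hB
      have hB : 0 < B := hB
      exact (ha.trans_le (csInf_le hbdd ⟨B / 2, half_pos hB, rfl⟩)).trans_le
        (hm (B / 2) B (half_pos hB) (half_lt_self hB)).1
    · intro a ha
      obtain ⟨_, ⟨B', hB', rfl⟩, h⟩ := exists_lt_of_csInf_lt hne ha
      filter_upwards [Ioo_mem_nhdsGT hB'] with B hB
      exact (hm B B' hB.1 hB.2).2.trans_lt h
  have hm₀lim : Tendsto m₀ (𝓝[>] 0) (𝓝 m_s) := hlim m₀ fun B B' _ h =>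
    ⟨hle h (hΦ₀ B) (hℓ₀ B) (hω₀ B) (hΦ₀ B') (hℓ₀ B') (hω₀ B'),
      hle h (hΦ₀ B) (hℓ₀ B) (hω₀ B) (hΦ₀ B') (hℓ₀ B') (hω₀ B')⟩
  have hupper : ∀ ω : QL d n →ₗ[ℂ] ℂ, IsGroundState ω → maxMag ω ≤ m_s := by
    intro ω hω
    refine le_csInf hne ?_
    rintro _ ⟨B, hB, rfl⟩
    have hB : 0 < B := hB
    -- The limit ω' need not be the reference one, so it is taken at B / 2, where strict
    -- monotonicity compares it with the reference at B.
    obtain ⟨ℓ, ω', hℓ, hω', h⟩ := hω.exists_maxMag_le (half_pos hB) (hΦ₀ (B / 2))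
    exact h.trans (hle (half_lt_self hB) (hΦ₀ _) hℓ hω' (hΦ₀ B) (hℓ₀ B) (hω₀ B))
  -- a ground state of period two with magnetization `m_s`
  have hex : ∃ ω : QL d n →ₗ[ℂ] ℂ, IsGroundState ω ∧ IsPeriodTwo ω ∧ magIn ω 1 = m_s := by
    set b : ℕ → ℝ := fun k => 1 / ((k : ℝ) + 1) with hb
    have hb0 : Tendsto b atTop (𝓝 0) := tendsto_one_div_add_atTop_nhds_zero_nat
    have hbpos : ∀ k, 0 < b k := fun k => Nat.one_div_pos_of_nat
    -- A diagonal choice: for each field b k, one box so large that the finite-volume magnetization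
    -- is within b k of its limit.
    have hchoose : ∀ k : ℕ, ∃ L, k ≤ L ∧ 1 ≤ L ∧ |magVec (Φ₀ (b k) L) - m₀ (b k)| < b k := by
      intro k
      have h1 := ((hω₀ (b k)).locTendsto (hℓ₀ (b k))).tendsto_magVec (hℓ₀ (b k))
        (((hΦ₀ (b k)).eventually (hℓ₀ (b k))).mono fun _ h => h.2)
      obtain ⟨j, h2, h3, h4⟩ := ((h1.eventually (Metric.ball_mem_nhds _ (hbpos k))).and
        (((hℓ₀ (b k)).eventually_ge_atTop k).and ((hℓ₀ (b k)).eventually_ge_atTop 1))).exists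
      exact ⟨_, h3, h4, h2⟩
    choose L hLk hL1 hLm using hchoose
    have hL : Tendsto L atTop atTop := tendsto_atTop_mono hLk tendsto_id
    obtain ⟨φ, ω, hφ, hω, hlimω⟩ := exists_locTendsto_subseq (fun k => Φ₀ (b k) (L k))
      (Eventually.of_forall fun k => (hΦ₀ (b k) _ (hL1 k)).1.1)
    have hLφ : Tendsto (fun k => L (φ k)) atTop atTop := hL.comp hφ.tendsto_atTop
    have hper : ∀ᶠ k in atTop, IsPeriodTwoVector (Φ₀ (b (φ k)) (L (φ k))) :=
      Eventually.of_forall fun k => (hΦ₀ (b (φ k)) _ (hL1 (φ k))).2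
    refine ⟨ω, hlimω.isGroundState hLφ (hb0.comp hφ.tendsto_atTop)
      (Eventually.of_forall fun k => (hΦ₀ (b (φ k)) _ (hL1 (φ k))).1) hω,
      hlimω.isPeriodTwo hLφ hper, tendsto_nhds_unique (hlimω.tendsto_magVec hLφ hper) ?_⟩
    have h1 : Tendsto (fun k => m₀ (b k)) atTop (𝓝 m_s) :=
      hm₀lim.comp (tendsto_nhdsWithin_iff.2 ⟨hb0, Eventually.of_forall hbpos⟩)
    have h2 : Tendsto (fun k => magVec (Φ₀ (b k) (L k)) - m₀ (b k)) atTop (𝓝 0) :=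
      squeeze_zero_norm (fun k => (hLm k).le) hb0
    have h3 := h2.add h1
    simp only [sub_add_cancel, zero_add] at h3
    exact h3.comp hφ.tendsto_atTop
  obtain ⟨ω, hgs, hper, hmag⟩ := hex
  have hconst : Tendsto (fun L => magIn ω L) atTop (𝓝 m_s) := by
    refine tendsto_const_nhds.congr' ?_
    filter_upwards [eventually_ge_atTop 1] with L hL
    rw [hper.magIn_eq hL, hmag]
  refine ⟨m_s, fun Φ ℓ ω h => ⟨fun B => magIn (ω B) 1, fun B hB => ⟨fun L hL => ?_, ?_⟩,
    hlim _ fun B B' hB hBB' => ⟨?_, ?_⟩⟩, ⟨⟨ω, hgs, hconst.limsup_eq.symm⟩, ?_⟩,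
    ⟨⟨ω, hgs, hper, hconst⟩, ?_⟩⟩
  · obtain ⟨h1, h2, h3⟩ := h B hB
    exact ((h3.locTendsto h2).isPeriodTwo h2 ((h1.eventually h2).mono fun _ h => h.2)).magIn_eq hL
  · obtain ⟨h1, h2, h3⟩ := h B hB
    exact (h3.locTendsto h2).tendsto_magVec h2 ((h1.eventually h2).mono fun _ h => h.2)
  · obtain ⟨h1, h2, h3⟩ := h B' (hB.trans hBB')
    exact hle hBB' (hΦ₀ B) (hℓ₀ B) (hω₀ B) h1 h2 h3
  · obtain ⟨h1, h2, h3⟩ := h B hB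
    exact hle hBB' h1 h2 h3 (hΦ₀ B') (hℓ₀ B') (hω₀ B')
  · rintro _ ⟨ω', hω', rfl⟩
    exact hupper ω' hω'
  · rintro m ⟨ω', hω', -, hm⟩
    rw [← hm.limsup_eq]
    exact hupper ω' hω'
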